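/- Setting. For $L>0$ let $\mathcal F_L$ be the set of $L$-Lipschitz functions $f:[0,1]\to[0,1]$. For a probability distribution $\mathcal D$ on $[0,1]\times[0,1]$ put $\mathrm{err}_{\mathcal D}(f)=\mathbb E_{(x,y)\sim\mathcal D}|y-f(x)|$ and $\mathrm{err}_{\mathcal D}(\mathcal F_L)=\inf_{f\in\mathcal F_L}\mathrm{err}_{\mathcal D}(f)$. Fix any rule that assigns to every finite list $T$ of labelled points an empirical risk minimizer $\hat f_T\in\arg\min_{f\in\mathcal F_L}\sum_{(x_j,y_j)\in T}|y_j-f(x_j)|$. Preprocess$(L,\mathcal D_x,\epsilon')$, with $\epsilon'=1/K$, $K\ge 1$ an integer, and with a sample-size constant $C$. Draw $b_1$ uniformly from $\{\frac1L,\frac2L,\dots,\frac KL\}$, put $b_0=0$, $b_2=b_1+\frac1L$, $b_3=b_2+\frac{1}{L\epsilon'}$, $b_4=b_3+\frac1L,\dots$, cut off at $1$. The partition $\mathcal P$ of $[0,1]$ consists of the intervals $I_i=[b_{i-1},b_i]$ with $b_{i-1}<1$; those with odd $i$ are called long, those with even $i$ short. Draw $M=\lceil C\,\frac{\max(L,\epsilon')}{\epsilon'^4}\log\frac1{\epsilon'}\rceil$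 independent points $x_1,\dots,x_M$ from the marginal $\mathcal D_x$; discard a point that falls into a long interval if more than $\frac1{2\epsilon'^4}\log\frac1{\epsilon'}$ earlier points fell into that interval. Let $S$ be the set of the remaining samples. Each $x_j$ has a fixed label $y_j$, revealed on request, such that the pairs $(x_j,y_j)$ are independent with law $\mathcal D$ and independent of $b_1$. Query$(x,S,\mathcal P)$. If $x$ is in a long interval $I_i$, ask for the labels of the samples in $S\cap I_i$ and output $\hat f_{S\cap I_i}(x)$. Otherwise $x$ is in a short interval $I_i$; ask for the labels of the samples in $S\cap(I_{i-1}\cup I_{i+1})$ and output $v^l+(x-b_{i-1})\frac{v^u-v^l}{b_i-b_{i-1}}$, where $v^l=\hat f_{S\cap I_{i-1}}(b_{i-1})$, and $v^u=\hat f_{S\cap I_{i+1}}(b_i)$ if $b_i<1$, while $v^u=v^l$ if $b_i=1$. Theorem. There are absolute constants $A,B,C>0$ such that the following holds for every distribution $\mathcal D$ on $[0,1]\times[0,1]$, every $L>0$ and every $\epsilon\in(0,1]$. Run Preprocess$(L,\mathcal D_x,\epsilon')$ with $\epsilon'=1/\lceil A/\epsilon\rceil$ and sample-size constant $C$. Then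 the number of samples drawn satisfies $M\le B\,\frac{\max(L,\epsilon)}{\epsilon^4}\log\frac2\epsilon$, which is $B\,\frac{L}{\epsilon^4}\log\frac2\epsilon$ if $L\ge\epsilon$. For every outcome of Preprocess and of the labels there is a function $\tilde f\in\mathcal F_L$ such that, for all $x\in[0,1]$, Query$(x,S,\mathcal P)$ asks only for labels of samples in $S$, asks for at most $B\,\frac1{\epsilon^4}\log\frac2\epsilon$ labels, and outputs $\tilde f(x)$. With probability greater than $\frac12$ this function satisfies $\mathrm{err}_{\mathcal D}(\tilde f)\le\mathrm{err}_{\mathcal D}(\mathcal F_L)+\epsilon$. -/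

import Mathlib

open MeasureTheory

noncomputable section

namespace LocalLipschitz

/-! ### Lipschitz functions and prediction error -/

/-- The class `F_L` of `L`-Lipschitz functions from `[0,1]` to `[0,1]`. -/
def lipClass (L : ℝ) : Set (unitInterval → unitInterval) :=
  {f | ∀ x y : unitInterval, |(f x : ℝ) - (f y : ℝ)| ≤ L * |(x : ℝ) - (y : ℝ)|}

/-- The prediction error of `f` with respect to a distribution `D` on `[0,1] × [0,1]`,
the expectation of `|y - f(x)|` for `(x,y)` drawn from `D`. -/
def err (D : Measure (unitInterval × unitInterval)) (f : unitInterval → unitInterval) : ℝ :=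
  ∫ p, |(p.2 : ℝ) - (f p.1 : ℝ)| ∂D

/-- The optimal prediction error of the class `F_L`. -/
def optErr (D : Measure (unitInterval × unitInterval)) (L : ℝ) : ℝ :=
  sInf (err D '' lipClass L)

/-- The (unnormalized) empirical error of `f` on a list of labelled points `(x, y)`. -/
def empErr (data : List (unitInterval × unitInterval)) (f : unitInterval → unitInterval) : ℝ :=
  (data.map fun p => |(p.2 : ℝ) - (f p.1 : ℝ)|).sum

/-- `f` is an empirical risk minimizer over `F_L` for the given labelled points. -/
def IsERM (L : ℝ) (data : List (unitInterval × unitInterval))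
    (f : unitInterval → unitInterval) : Prop :=
  f ∈ lipClass L ∧ ∀ g ∈ lipClass L, empErr data f ≤ empErr data g

/-- Empirical risk minimizers exist for every finite list of labelled points. -/
theorem exists_isERM {L : ℝ} (hL : 0 ≤ L) (data : List (unitInterval × unitInterval)) :
    ∃ f, IsERM L data f := by
  have hclosed : IsClosed (lipClass L) := by
    simp only [lipClass, Set.ofPred_forall]
    refine isClosed_iInter fun x => isClosed_iInter fun y => ?_
    exact isClosed_le (by fun_prop) continuous_const
  have hne : (lipClass L).Nonempty :=
    ⟨fun _ => 0, fun x y => by simpa using mul_nonneg hL (abs_nonneg _)⟩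
  have hcont : Continuous (empErr data) := by
    unfold empErr
    induction data with
    | nil => simpa using continuous_const
    | cons p l ih =>
      simp only [List.map_cons, List.sum_cons]
      exact Continuous.add (by fun_prop) ih
  obtain ⟨f, hf, hmin⟩ := hclosed.isCompact.exists_isMinOn hne hcont.continuousOn
  exact ⟨f, hf, fun g hg => hmin hg⟩

/-! ### Computations with access to a label oracle -/

/-- A deterministic computation with result in `α` that may ask, adaptively and one at a time,
for the labels of samples with index in `ι`. -/
inductive LabelComp (ι α : Type) : Type where
  /-- stop and return a result -/
  | ret (a : α) : LabelComp ι α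
  /-- ask for the label of sample `i`, and continue in dependence on the answer -/
  | ask (i : ι) (k : unitInterval → LabelComp ι α) : LabelComp ι α

namespace LabelComp

variable {ι α β : Type}

/-- Sequential composition. -/
def bind : LabelComp ι α → (α → LabelComp ι β) → LabelComp ι β
  | ret a, g => g a
  | ask i k, g => ask i fun y => (k y).bind g

/-- The result of a computation when the labels are `y`. -/
def output (y : ι → unitInterval) : LabelComp ι α → α
  | ret a => a
  | ask i k => (k (y i)).output y

/-- The list of all label queries made by a computation when the labels are `y`. -/
def queries (y : ι → unitInterval) : LabelComp ι α → List ι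
  | ret _ => []
  | ask i k => i :: (k (y i)).queries y

/-- Ask for the labels of the listed samples, and return the list of labelled samples. -/
def collect (pts : ι → unitInterval) : List ι → LabelComp ι (List (unitInterval × unitInterval))
  | [] => ret []
  | i :: l => ask i fun y => (collect pts l).bind fun data => ret ((pts i, y) :: data)

end LabelComp

/-! ### Preprocessing -/

/-- Unclipped breakpoints for inverse accuracy `K` and offset `m / L`: from `0`, first a long
interval of length `m / L`, then alternately short intervals of length `1 / L` and long intervals
of length `K / L`. -/
def rawBreak (L : ℝ) (K m : ℕ) : ℕ → ℝ
  | 0 => 0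
  | n + 1 => rawBreak L K m n +
      (if n = 0 then (m : ℝ) / L else if Even n then (K : ℝ) / L else 1 / L)

/-- Breakpoints `b_0 = 0 < b_1 < ...`, cut off at `1`. -/
def breakpoint (L : ℝ) (K m : ℕ) (n : ℕ) : unitInterval :=
  Set.projIcc (0 : ℝ) 1 zero_le_one (rawBreak L K m n)

/-- The interval `[b_i, b_{i+1}]` of a partition of `[0,1]` with breakpoints `b`. The partition ends
with the interval that reaches `1`; for later indices this is the empty set. The long
intervals are those with even `i`, the short ones those with odd `i`. -/
def cell (b : ℕ → unitInterval) (i : ℕ) : Set unitInterval :=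
  {x | b i < 1 ∧ b i ≤ x ∧ x ≤ b (i + 1)}

/-- What the preprocessing step returns: a sequence of `M` unlabelled points, the
set of indices of those that are kept, and the breakpoints of the partition. -/
structure Prepared (M : ℕ) where
  /-- the drawn points -/
  pts : Fin M → unitInterval
  /-- the indices of the samples that are not discarded: they form the sample set `S` -/
  kept : Finset (Fin M)
  /-- the breakpoints -/
  b : ℕ → unitInterval

/-- The number of unlabelled samples that are drawn, for inverse accuracy `K = 1 / ε'`:
`C (L / ε' ^ 4) log (1 / ε')` rounded up, where `L` is replaced by `ε'` if it is smaller. -/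
def sampleSize (C L : ℝ) (K : ℕ) : ℕ :=
  ⌈C * max L (1 / (K : ℝ)) * (K : ℝ) ^ 4 * Real.log K⌉₊

open Classical in
/-- The preprocessing step for inverse accuracy `K = 1 / ε'`, as a function of its random choices:
the number `r : Fin K`, which makes the offset one of `1/L, 2/L, ..., K/L`, and
the unlabelled points `pts`. A sample that falls into a long interval is discarded if more
than `(1/2) (1 / ε' ^ 4) log (1 / ε')` earlier samples fell into that interval. -/
def preprocess (L : ℝ) (K : ℕ) {M : ℕ} (r : Fin K) (pts : Fin M → unitInterval) : Prepared M where
  pts := pts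
  b := breakpoint L K (r + 1)
  kept := Finset.univ.filter fun j => ∀ i : ℕ, Even i → pts j ∈ cell (breakpoint L K (r + 1)) i →
    ((Finset.univ.filter fun j' : Fin M =>
        j' < j ∧ pts j' ∈ cell (breakpoint L K (r + 1)) i).card : ℝ) ≤
      1 / 2 * (K : ℝ) ^ 4 * Real.log K

/-- The law of all random choices: the offset is uniform on its `K` values, and independently of it
`M` independent labelled samples `(x_j, y_j)` are drawn from `D`. The preprocessing step sees only
the `x_j`; the label `y_j` is fixed with the sample and is revealed when it is asked for. -/
def law (D : Measure (unitInterval × unitInterval)) (K M : ℕ) :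
    Measure (Fin K × (Fin M → unitInterval × unitInterval)) :=
  (ProbabilityTheory.uniformOn (Set.univ : Set (Fin K))).prod (Measure.pi fun _ => D)

/-! ### Answering a query -/

open Classical in
/-- The kept samples in the `i`-th interval of the partition, in the order in which
they were drawn. -/
def samplesIn {M : ℕ} (P : Prepared M) (i : ℕ) : List (Fin M) :=
  (List.finRange M).filter fun j => j ∈ P.kept ∧ P.pts j ∈ cell P.b i

open Classical in
/-- The answer to a query at `x`. Here `erm` is the rule that
picks an empirical risk minimizer for given labelled points. If `x` is in a long interval, ask for
the labels in that interval and evaluate the minimizer. If `x` is in a short interval, ask for the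
labels in the two neighbouring long intervals, and interpolate linearly between the values
of the two minimizers at the end points; if a neighbour does not exist, the value from the other
side is used at both ends. The last branch does not occur. -/
def query {M : ℕ} (erm : List (unitInterval × unitInterval) → unitInterval → unitInterval)
    (P : Prepared M) (x : unitInterval) : LabelComp (Fin M) ℝ :=
  if hl : ∃ i, Even i ∧ x ∈ cell P.b i then
    let i := Nat.find hl
    (LabelComp.collect P.pts (samplesIn P i)).bind fun data =>
      LabelComp.ret (erm data x : ℝ)
  else if hs : ∃ i, Odd i ∧ x ∈ cell P.b i then
    let i := Nat.find hs
    (LabelComp.collect P.pts (samplesIn P (i - 1))).bind fun dataL =>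
      (LabelComp.collect P.pts (samplesIn P (i + 1))).bind fun dataR =>
        let vl : ℝ := if 0 < P.b i then erm dataL (P.b i) else erm dataR (P.b (i + 1))
        let vu : ℝ := if P.b (i + 1) < 1 then erm dataR (P.b (i + 1)) else erm dataL (P.b i)
        LabelComp.ret
          (vl + ((x : ℝ) - (P.b i : ℝ)) * ((vu - vl) / ((P.b (i + 1) : ℝ) - (P.b i : ℝ))))
  else LabelComp.ret 0

end LocalLipschitz

end

noncomputable section

namespace LocalLipschitz

/-! ### Sums with predictable coefficients over independent samples -/

section Predictable

variable {Z : Type*} [MeasurableSpace Z] {M : ℕ}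

/-! The Lipschitz and query claims hold for every outcome. On a long interval the answers are those
of one minimizer; a short interval that ends before `1` has length exactly `1 / L`, so interpolating
between two values in `[0,1]` has slope at most `L`; a short interval reaching `1` gets a constant
(`lipschitz_output_query`). A query reads at most two long intervals, each capped (`queries_query`).

For the error, compare with an arbitrary `g` in the class. Outside the long intervals the excess
loss is at most the mass there. In units of `1 / L` the partition has period `K + 1`, and each point
is outside the long intervals for at most one of the `K` offsets, so this mass is at most `1 / K` on
average (`sum_measureReal_shortRegion_le`).

On a long interval `I`, the loss difference `h` of the minimizer and `g` has nonpositive sum over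
the kept samples. Hence its mean over `I` is controlled by the fluctuation of that sum, uniformly
over Lipschitz pairs. Whether a sample is kept depends only on earlier samples, so fluctuations are
sums with predictable coefficients and their second moments add up (`integral_sq_sum_predictable`).
Uniformity comes from chaining over two grids, of mesh `1 / J ^ 2` and `1 / J` with `J ^ 2` of order
`K` (`abs_fluctuation_le`). An interval of length `K / L` has about `K ^ 3` fine and `K ^ 2` coarse
squares. With `n` kept samples Cauchy–Schwarz gives `(1 / J) * √(K ^ 3 * n) + √(K ^ 2 * n)`, of
order `K * √n`, which is at most `n / K` once `n` is of order `K ^ 4`. The fine grid alone would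
require `K ^ 5`.

The resulting bound depends on the samples but not on the minimizer or `g`. It is integrated cell by
cell (`integral_excessBound_le`), summed (`err_le_add_totalBound`, `integral_totalBound_le`), and
Markov's inequality concludes (`half_lt_law`). -/

theorem integrable_of_abs_le {Ω : Type*} [MeasurableSpace Ω] {μ : Measure Ω} [IsFiniteMeasure μ]
    {f : Ω → ℝ} (hf : Measurable f) {c : ℝ} (hc : ∀ ω, |f ω| ≤ c) : Integrable f μ :=
  Integrable.of_bound hf.aestronglyMeasurable c (ae_of_all _ hc)

theorem integral_eval (D : Measure Z) [IsProbabilityMeasure D] (j : Fin M) {g : Z → ℝ}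
    (hg : Measurable g) :
    ∫ ω : Fin M → Z, g (ω j) ∂(Measure.pi fun _ => D) = ∫ z, g z ∂D := by
  have h := (measurePreserving_eval (fun _ : Fin M => D) j).map_eq
  conv_rhs => rw [← h]
  rw [integral_map (measurable_pi_apply j).aemeasurable hg.aestronglyMeasurable]

/-- A function that does not depend on the `j`-th sample is independent of that sample. -/
theorem integral_mul_eval (D : Measure Z) [IsProbabilityMeasure D] (j : Fin M)
    {F : (Fin M → Z) → ℝ} (hF : Measurable F)
    (hdep : ∀ ω z, F (Function.update ω j z) = F ω) {g : Z → ℝ} (hg : Measurable g) :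
    ∫ ω, F ω * g (ω j) ∂(Measure.pi fun _ => D) =
      (∫ ω, F ω ∂(Measure.pi fun _ => D)) * ∫ z, g z ∂D := by
  obtain ⟨z₀⟩ := nonempty_of_isProbabilityMeasure D
  have hind := ProbabilityTheory.iIndepFun_pi (Ω := fun _ : Fin M => Z) (𝓧 := fun _ => Z)
    (μ := fun _ => D) (X := fun _ z => z) (fun _ => aemeasurable_id)
  have h2 := hind.indepFun_finset (Finset.univ.erase j) {j} (by simp)
    (fun i => measurable_pi_apply i)
  -- `G` is `F` with the `j`-th coordinate frozen at `z₀`. By `hdep` it agrees with `F`, and it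
  -- reads only the remaining coordinates, which are independent of the `j`-th.
  let G : (((Finset.univ.erase j : Finset (Fin M)) : Type) → Z) → ℝ := fun w =>
    F fun i => if h : i ∈ Finset.univ.erase j then w ⟨i, h⟩ else z₀
  have hG : Measurable G := by
    refine hF.comp (measurable_pi_lambda _ fun i => ?_)
    by_cases h : i ∈ Finset.univ.erase j
    · simp only [h, dif_pos]
      exact measurable_pi_apply _
    · simp only [h, dif_neg, not_false_eq_true]
      exact measurable_const
  have h3 := h2.comp (φ := G) (ψ := fun w : (({j} : Finset (Fin M)) : Type) → Z => g (w ⟨j, by simp⟩)) hG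
    (hg.comp (measurable_pi_apply _))
  have h4 : (fun ω : Fin M → Z => F ω) =
      G ∘ fun ω (i : ((Finset.univ.erase j : Finset (Fin M)) : Type)) => ω i := by
    ext ω
    rw [← hdep ω z₀]
    simp only [G, Function.comp_apply]
    congr 1
    ext i
    by_cases h : i = j
    · subst h; simp
    · simp [h]
  have h5 := h3.integral_fun_mul_eq_mul_integral
    (hG.comp (measurable_pi_lambda _ fun i => measurable_pi_apply _)).aestronglyMeasurable
    ((hg.comp (measurable_pi_apply _)).comp
      (measurable_pi_lambda _ fun i => measurable_pi_apply _)).aestronglyMeasurable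
  rw [← h4] at h5
  refine h5.trans ?_
  congr 1
  exact integral_eval D j hg

/-- Second moment of a sum of centred terms with predictable coefficients. -/
theorem integral_sq_sum_predictable (D : Measure Z) [IsProbabilityMeasure D]
    {a : Fin M → (Fin M → Z) → ℝ} (ha : ∀ j, Measurable (a j)) (ha1 : ∀ j ω, |a j ω| ≤ 1)
    (hdep : ∀ j k, j ≤ k → ∀ ω z, a j (Function.update ω k z) = a j ω)
    {g : Z → ℝ} (hg : Measurable g) {c : ℝ} (hc : ∀ z, |g z| ≤ c) (hg0 : ∫ z, g z ∂D = 0) :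
    ∫ ω, (∑ j, a j ω * g (ω j)) ^ 2 ∂(Measure.pi fun _ => D) =
      (∑ j, ∫ ω, a j ω ^ 2 ∂(Measure.pi fun _ => D)) * ∫ z, g z ^ 2 ∂D := by
  have hT : ∀ j, Measurable fun ω : Fin M → Z => a j ω * g (ω j) := fun j =>
    (ha j).mul (hg.comp (measurable_pi_apply j))
  have hTb : ∀ j (ω : Fin M → Z), |a j ω * g (ω j)| ≤ c := fun j ω => by
    rw [abs_mul]
    have := mul_le_mul (ha1 j ω) (hc (ω j)) (abs_nonneg _) zero_le_one
    linarith
  have hint : ∀ j k, Integrable (fun ω : Fin M → Z => (a j ω * g (ω j)) * (a k ω * g (ω k)))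
      (Measure.pi fun _ => D) := fun j k => by
    refine integrable_of_abs_le ((hT j).mul (hT k)) (c := c * c) fun ω => ?_
    rw [abs_mul]
    exact mul_le_mul (hTb j ω) (hTb k ω) (abs_nonneg _) ((abs_nonneg _).trans (hTb j ω))
  -- For `j < k` every factor except `g (ω k)` ignores the `k`-th sample, so the expectation factors
  -- through `∫ g = 0`: cross terms vanish as for martingale differences.
  have hlt : ∀ j k, j < k →
      ∫ ω, (a j ω * g (ω j)) * (a k ω * g (ω k)) ∂(Measure.pi fun _ : Fin M => D) = 0 := by
    intro j k hjk
    have := integral_mul_eval D k (F := fun ω => a j ω * g (ω j) * a k ω)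
      ((hT j).mul (ha k)) (fun ω z => by
        simp only [hdep j k hjk.le, hdep k k le_rfl, Function.update_of_ne hjk.ne]) hg
    rw [hg0, mul_zero] at this
    rw [← this]
    congr 1; ext ω; ring
  have hdiag : ∀ j, ∫ ω, (a j ω * g (ω j)) * (a j ω * g (ω j)) ∂(Measure.pi fun _ : Fin M => D) =
      (∫ ω, a j ω ^ 2 ∂(Measure.pi fun _ => D)) * ∫ z, g z ^ 2 ∂D := by
    intro j
    rw [← integral_mul_eval D j (F := fun ω => a j ω ^ 2) ((ha j).pow_const 2)
      (fun ω z => by simp only [hdep j j le_rfl]) (hg.pow_const 2)]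
    congr 1; ext ω; ring
  simp_rw [sq (∑ j, _), Finset.sum_mul_sum]
  rw [integral_finsetSum _ fun j _ => integrable_finsetSum _ fun k _ => hint j k, Finset.sum_mul]
  refine Finset.sum_congr rfl fun j _ => ?_
  rw [integral_finsetSum _ fun k _ => hint j k, Finset.sum_eq_single j, hdiag]
  · intro k _ hkj
    rcases lt_or_gt_of_ne hkj with h | h
    · rw [← hlt k j h]
      congr 1; ext ω; ring
    · exact hlt j k h
  · simp

end Predictable

/-! ### Samples in a cell, with a cap on their number -/

section Capped

variable {Z : Type*} {M : ℕ}

/-- The number of samples before the `j`-th one that lie in `I`. -/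
def priorCount (I : Set Z) (ω : Fin M → Z) (j : Fin M) : ℝ :=
  ∑ i ∈ Finset.univ.filter (· < j), I.indicator (fun _ => (1 : ℝ)) (ω i)

/-- Whether at most `τ` of the samples before the `j`-th one lie in `I`. -/
def active (I : Set Z) (τ : ℝ) (j : Fin M) (ω : Fin M → Z) : ℝ :=
  if priorCount I ω j ≤ τ then 1 else 0

/-- The number of samples in `I`. -/
def hits (I : Set Z) (ω : Fin M → Z) : ℝ := ∑ j, I.indicator (fun _ => (1 : ℝ)) (ω j)

/-- The number of samples in `I` that are kept. -/
def keptHits (I : Set Z) (τ : ℝ) (ω : Fin M → Z) : ℝ :=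
  ∑ j, active I τ j ω * I.indicator (fun _ => (1 : ℝ)) (ω j)

theorem active_nonneg (I : Set Z) (τ : ℝ) (j : Fin M) (ω) : 0 ≤ active I τ j ω := by
  unfold active; split_ifs <;> norm_num

theorem active_le_one (I : Set Z) (τ : ℝ) (j : Fin M) (ω) : active I τ j ω ≤ 1 := by
  unfold active; split_ifs <;> norm_num

theorem active_sq (I : Set Z) (τ : ℝ) (j : Fin M) (ω) : active I τ j ω ^ 2 = active I τ j ω := by
  unfold active; split_ifs <;> norm_num

theorem abs_active_le (I : Set Z) (τ : ℝ) (j : Fin M) (ω) : |active I τ j ω| ≤ 1 := by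
  rw [abs_of_nonneg (active_nonneg ..)]; exact active_le_one ..

/-- Only strictly earlier samples decide whether the `j`-th one is kept. The case `j = k` is what
makes the coefficients predictable. -/
theorem active_update {I : Set Z} {τ : ℝ} {j k : Fin M} (h : j ≤ k) (ω : Fin M → Z) (z : Z) :
    active I τ j (Function.update ω k z) = active I τ j ω := by
  have : priorCount I (Function.update ω k z) j = priorCount I ω j := by
    refine Finset.sum_congr rfl fun i hi => ?_
    rw [Function.update_of_ne]
    exact ((Finset.mem_filter.1 hi).2.trans_le h).ne
  simp only [active, this]

theorem indicator_one_mem_Icc (I : Set Z) (z : Z) :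
    I.indicator (fun _ => (1 : ℝ)) z ∈ Set.Icc (0 : ℝ) 1 := by
  by_cases h : z ∈ I <;> simp [h]

theorem keptHits_nonneg (I : Set Z) (τ : ℝ) (ω : Fin M → Z) : 0 ≤ keptHits I τ ω :=
  Finset.sum_nonneg fun j _ => mul_nonneg (active_nonneg ..) (indicator_one_mem_Icc I (ω j)).1

theorem keptHits_le_hits (I : Set Z) (τ : ℝ) (ω : Fin M → Z) : keptHits I τ ω ≤ hits I ω :=
  Finset.sum_le_sum fun j _ =>
    mul_le_of_le_one_left (indicator_one_mem_Icc I (ω j)).1 (active_le_one ..)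

theorem hits_nonneg (I : Set Z) (ω : Fin M → Z) : 0 ≤ hits I ω :=
  Finset.sum_nonneg fun j _ => (indicator_one_mem_Icc I (ω j)).1

theorem hits_le (I : Set Z) (ω : Fin M → Z) : hits I ω ≤ M := by
  have : hits I ω ≤ ∑ _j : Fin M, (1 : ℝ) :=
    Finset.sum_le_sum fun j _ => (indicator_one_mem_Icc I (ω j)).2
  simpa using this

/-- All kept samples in `I` except the last are among those counted before the last one, and that
count is at most `τ`; the last one accounts for the `1`. -/
theorem keptHits_le_cap (I : Set Z) {τ : ℝ} (hτ : 0 ≤ τ) (ω : Fin M → Z) :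
    keptHits I τ ω ≤ τ + 1 := by
  classical
  set S : Finset (Fin M) := Finset.univ.filter fun j => priorCount I ω j ≤ τ ∧ ω j ∈ I with hS
  have hterm : ∀ j, active I τ j ω * I.indicator (fun _ => (1 : ℝ)) (ω j) =
      if j ∈ S then 1 else 0 := by
    intro j
    by_cases h1 : priorCount I ω j ≤ τ <;> by_cases h2 : ω j ∈ I <;> simp [active, hS, h1, h2]
  simp only [keptHits, hterm]
  rw [Finset.sum_ite_mem, Finset.univ_inter]
  rcases S.eq_empty_or_nonempty with h | h
  · rw [h]; simp; linarith
  · set k := S.max' h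
    have hk : k ∈ S := S.max'_mem h
    rw [← Finset.sum_erase_add _ _ hk]
    refine add_le_add ?_ le_rfl
    refine le_trans ?_ (Finset.mem_filter.1 hk).2.1
    have hsub : S.erase k ⊆ Finset.univ.filter (· < k) := fun j hj => by
      simp only [Finset.mem_filter, Finset.mem_univ, true_and]
      exact lt_of_le_of_ne (S.le_max' j (Finset.mem_of_mem_erase hj)) (Finset.ne_of_mem_erase hj)
    refine le_trans ?_ (Finset.sum_le_sum_of_subset_of_nonneg hsub
      fun i _ _ => (indicator_one_mem_Icc I (ω i)).1)
    refine Finset.sum_le_sum fun j hj => ?_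
    rw [Set.indicator_of_mem (Finset.mem_filter.1 (Finset.mem_of_mem_erase hj)).2.2]

/-- Either all samples in `I` are kept, or more than `τ` of them. -/
theorem min_hits_le_keptHits (I : Set Z) (τ : ℝ) (ω : Fin M → Z) :
    min (hits I ω) τ ≤ keptHits I τ ω := by
  classical
  by_cases hall : ∀ j, ω j ∈ I → priorCount I ω j ≤ τ
  · refine (min_le_left _ _).trans (Finset.sum_le_sum fun j _ => ?_)
    by_cases hj : ω j ∈ I
    · simp [active, hall j hj]
    · simp [hj]
  · refine (min_le_right _ _).trans ?_
    push Not at hall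
    set S : Finset (Fin M) := Finset.univ.filter fun j => ω j ∈ I ∧ τ < priorCount I ω j with hS
    have hne : S.Nonempty := by
      obtain ⟨j, h1, h2⟩ := hall
      exact ⟨j, by simp [hS, h1, h2]⟩
    -- `k` is the first sample in `I` that is refused. All samples in `I` before it are kept, and
    -- there are more than `τ` of them.
    set k := S.min' hne
    have hk : k ∈ S := S.min'_mem hne
    refine (Finset.mem_filter.1 hk).2.2.le.trans ?_
    refine le_trans ?_ (Finset.sum_le_sum_of_subset_of_nonneg
      (Finset.subset_univ (Finset.univ.filter (· < k)))
      fun i _ _ => mul_nonneg (active_nonneg ..) (indicator_one_mem_Icc I (ω i)).1)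
    refine Finset.sum_le_sum fun j hj => ?_
    by_cases hjI : ω j ∈ I
    · have : priorCount I ω j ≤ τ := by
        by_contra hcon
        have hjS : j ∈ S := by simp [hS, hjI, not_le.1 hcon]
        exact absurd (S.min'_le j hjS) (not_le.2 (Finset.mem_filter.1 hj).2)
      simp [active, this]
    · simp [hjI]

/-- The number of kept samples falls short of a target `t ≤ τ`, `t ≤ ν / 2`, by at most
the squared deviation of the number of samples from `ν`, divided by `2 ν`. -/
theorem sub_keptHits_le (I : Set Z) {τ ν t : ℝ} (hν : 0 < ν) (ht : t ≤ τ) (ht2 : t ≤ ν / 2)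
    (ω : Fin M → Z) : t - keptHits I τ ω ≤ (hits I ω - ν) ^ 2 / (2 * ν) := by
  have h0 : 0 ≤ (hits I ω - ν) ^ 2 / (2 * ν) := by positivity
  rcases min_le_iff.1 (min_hits_le_keptHits I τ ω) with h | h
  -- Nothing in `I` is lost here. The inequality `ν / 2 - hits ≤ (hits - ν) ^ 2 / (2 * ν)` is the
  -- nonnegativity of `hits ^ 2 / (2 * ν)`.
  · have : (hits I ω - ν) ^ 2 / (2 * ν) - (ν / 2 - hits I ω) = hits I ω ^ 2 / (2 * ν) := by
      field_simp; ring
    have h2 : 0 ≤ hits I ω ^ 2 / (2 * ν) := by positivity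
    linarith
  · linarith

/-! ### Moments of the capped counts and fluctuations -/

variable [MeasurableSpace Z]

/-- The sum of `φ` over the kept samples in `I`, minus their number times the mean of `φ`
on `I`. -/
def fluctuation (D : Measure Z) (I : Set Z) (τ : ℝ) (φ : Z → ℝ) (ω : Fin M → Z) : ℝ :=
  ∑ j, active I τ j ω *
    (I.indicator φ (ω j) - (∫ z in I, φ z ∂D) / D.real I * I.indicator (fun _ => (1 : ℝ)) (ω j))

theorem measurable_indicator_one {I : Set Z} (hI : MeasurableSet I) :
    Measurable (I.indicator (fun _ => (1 : ℝ))) := measurable_const.indicator hI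

theorem measurable_active {I : Set Z} (hI : MeasurableSet I) (τ : ℝ) (j : Fin M) :
    Measurable (active I τ j) := by
  have : Measurable fun ω : Fin M → Z => priorCount I ω j :=
    Finset.measurable_sum _ fun i _ => (measurable_indicator_one hI).comp (measurable_pi_apply i)
  exact Measurable.ite (measurableSet_le this measurable_const) measurable_const measurable_const

theorem measurable_hits {I : Set Z} (hI : MeasurableSet I) :
    Measurable (hits I : (Fin M → Z) → ℝ) :=
  Finset.measurable_sum _ fun i _ => (measurable_indicator_one hI).comp (measurable_pi_apply i)

theorem measurable_keptHits {I : Set Z} (hI : MeasurableSet I) (τ : ℝ) :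
    Measurable (keptHits I τ : (Fin M → Z) → ℝ) :=
  Finset.measurable_sum _ fun i _ => (measurable_active hI τ i).mul
    ((measurable_indicator_one hI).comp (measurable_pi_apply i))

theorem measurable_fluctuation {D : Measure Z} {I : Set Z} (hI : MeasurableSet I) (τ : ℝ)
    {φ : Z → ℝ} (hφ : Measurable φ) :
    Measurable (fluctuation D I τ φ : (Fin M → Z) → ℝ) := by
  refine Finset.measurable_sum _ fun i _ => (measurable_active hI τ i).mul ?_
  exact ((hφ.indicator hI).comp (measurable_pi_apply i)).sub
    (((measurable_indicator_one hI).comp (measurable_pi_apply i)).const_mul _)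

variable (D : Measure Z) [IsProbabilityMeasure D] {I : Set Z}

theorem integral_indicator_one_eq (D : Measure Z) {I : Set Z} (hI : MeasurableSet I) :
    ∫ z, I.indicator (fun _ => (1 : ℝ)) z ∂D = D.real I := by
  rw [integral_indicator hI]; simp

/-- Wald's identity: the decision to keep the `j`-th sample is independent of where that sample
falls. -/
theorem integral_keptHits (hI : MeasurableSet I) (τ : ℝ) :
    ∫ ω, keptHits I τ ω ∂(Measure.pi fun _ : Fin M => D) =
      (∑ j, ∫ ω, active I τ j ω ∂(Measure.pi fun _ : Fin M => D)) * D.real I := by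
  unfold keptHits
  rw [integral_finsetSum, Finset.sum_mul]
  · refine Finset.sum_congr rfl fun j _ => ?_
    rw [integral_mul_eval D j (measurable_active hI τ j) (active_update le_rfl)
      (measurable_indicator_one hI), integral_indicator_one_eq D hI]
  · intro j _
    refine integrable_of_abs_le (c := 1) ((measurable_active hI τ j).mul
      ((measurable_indicator_one hI).comp (measurable_pi_apply j))) fun ω => ?_
    have h1 := indicator_one_mem_Icc I (ω j)
    rw [abs_mul, abs_of_nonneg h1.1]
    exact mul_le_one₀ (abs_active_le ..) h1.1 h1.2

theorem integrable_keptHits (hI : MeasurableSet I) (τ : ℝ) :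
    Integrable (keptHits I τ) (Measure.pi fun _ : Fin M => D) :=
  integrable_of_abs_le (c := M) (measurable_keptHits hI τ) fun ω => by
    rw [abs_of_nonneg (keptHits_nonneg ..)]
    exact (keptHits_le_hits ..).trans (hits_le ..)

theorem integral_hits (hI : MeasurableSet I) :
    ∫ ω, hits I ω ∂(Measure.pi fun _ : Fin M => D) = M * D.real I := by
  unfold hits
  rw [integral_finsetSum]
  · simp_rw [integral_eval D _ (measurable_indicator_one hI), integral_indicator_one_eq D hI]
    simp
  · intro j _
    refine integrable_of_abs_le (c := 1)
      ((measurable_indicator_one hI).comp (measurable_pi_apply j)) fun ω => ?_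
    have h1 := indicator_one_mem_Icc I (ω j)
    rw [abs_of_nonneg h1.1]
    exact h1.2

theorem integrable_hits (hI : MeasurableSet I) :
    Integrable (hits I) (Measure.pi fun _ : Fin M => D) :=
  integrable_of_abs_le (c := M) (measurable_hits hI) fun ω => by
    rw [abs_of_nonneg (hits_nonneg ..)]
    exact hits_le ..

theorem integral_keptHits_le (hI : MeasurableSet I) {τ : ℝ} (hτ : 0 ≤ τ) :
    ∫ ω, keptHits I τ ω ∂(Measure.pi fun _ : Fin M => D) ≤ min (M * D.real I) (τ + 1) := by
  refine le_min ?_ ?_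
  · rw [← integral_hits D hI]
    exact integral_mono (integrable_keptHits D hI τ) (integrable_hits D hI) (keptHits_le_hits I τ)
  · have := integral_mono (integrable_keptHits (M := M) D hI τ) (integrable_const (τ + 1))
      (keptHits_le_cap I hτ)
    simpa using this

/-- The binomial variance, as the case of predictable coefficients all equal to `1`. -/
theorem integral_sq_hits_sub_le (hI : MeasurableSet I) :
    ∫ ω, (hits I ω - M * D.real I) ^ 2 ∂(Measure.pi fun _ : Fin M => D) ≤ M * D.real I := by
  have h := integral_sq_sum_predictable (M := M) D (a := fun _ _ => 1)
    (fun _ => measurable_const) (fun _ _ => by simp) (fun _ _ _ _ _ => rfl)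
    (g := fun z => I.indicator (fun _ => (1 : ℝ)) z - D.real I)
    ((measurable_indicator_one hI).sub_const _) (c := 1) (fun z => by
      have h1 := indicator_one_mem_Icc I z
      have h2 : D.real I ≤ 1 := measureReal_le_one
      have h3 : 0 ≤ D.real I := measureReal_nonneg
      rw [abs_le]; constructor <;> linarith [h1.1, h1.2])
    (by
      rw [integral_sub, integral_indicator_one_eq D hI]
      · simp
      · exact (integrable_const (1 : ℝ)).indicator hI
      · exact integrable_const _)
  have h1 : (fun ω : Fin M → Z => (hits I ω - M * D.real I) ^ 2) = fun ω =>
      (∑ j, (1 : ℝ) * (I.indicator (fun _ => (1 : ℝ)) (ω j) - D.real I)) ^ 2 := by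
    ext ω; simp [hits, Finset.sum_sub_distrib]
  rw [h1, h]
  have hexp : ∀ z, (I.indicator (fun _ => (1 : ℝ)) z - D.real I) ^ 2 =
      I.indicator (fun _ => (1 : ℝ)) z * (1 - 2 * D.real I) + D.real I ^ 2 := by
    intro z; by_cases hz : z ∈ I <;> simp [hz]; ring
  simp_rw [hexp]
  rw [integral_add, integral_mul_const, integral_indicator_one_eq D hI]
  · simp only [one_pow, integral_const, probReal_univ, smul_eq_mul, mul_one, Finset.sum_const,
      Finset.card_univ, Fintype.card_fin, nsmul_eq_mul, one_mul]
    have : (0 : ℝ) ≤ M := Nat.cast_nonneg _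
    nlinarith [mul_nonneg this (sq_nonneg (D.real I))]
  · exact ((integrable_const (1 : ℝ)).indicator hI).mul_const _
  · exact integrable_const _

theorem abs_centred_le {B : Set Z} (hB : MeasurableSet B) (z : Z) :
    |I.indicator (B.indicator fun _ => (1 : ℝ)) z -
      (∫ z in I, B.indicator (fun _ => (1 : ℝ)) z ∂D) / D.real I *
        I.indicator (fun _ => (1 : ℝ)) z| ≤ 1 := by
  have hm : ∫ z in I, B.indicator (fun _ => (1 : ℝ)) z ∂D = D.real (B ∩ I) := by
    rw [integral_indicator hB, Measure.restrict_restrict hB]; simp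
  rw [hm]
  have h1 : 0 ≤ D.real (B ∩ I) / D.real I := div_nonneg measureReal_nonneg measureReal_nonneg
  have h2 : D.real (B ∩ I) / D.real I ≤ 1 :=
    div_le_one_of_le₀ (measureReal_mono Set.inter_subset_right) measureReal_nonneg
  by_cases hz : z ∈ I <;> by_cases hzB : z ∈ B <;> simp only [Set.indicator_of_mem,
    Set.indicator_of_notMem, hz, hzB, not_false_eq_true] <;> rw [abs_le] <;> constructor <;>
    linarith

/-- Second moment of the fluctuation of the indicator of a set. -/
theorem integral_sq_fluctuation_le (hI : MeasurableSet I) (τ : ℝ) (hq : 0 < D.real I)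
    {B : Set Z} (hB : MeasurableSet B) :
    ∫ ω, fluctuation D I τ (B.indicator fun _ => 1) ω ^ 2 ∂(Measure.pi fun _ : Fin M => D) ≤
      (∑ j, ∫ ω, active I τ j ω ∂(Measure.pi fun _ : Fin M => D)) * D.real (B ∩ I) := by
  have hm : ∫ z in I, B.indicator (fun _ => (1 : ℝ)) z ∂D = D.real (B ∩ I) := by
    rw [integral_indicator hB, Measure.restrict_restrict hB]; simp
  have hii : I.indicator (B.indicator fun _ => (1 : ℝ)) = (B ∩ I).indicator fun _ => 1 := by
    rw [Set.indicator_indicator, Set.inter_comm]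
  have hint1 : Integrable (I.indicator (B.indicator fun _ => (1 : ℝ))) D :=
    ((integrable_const (1 : ℝ)).indicator hB).indicator hI
  have hint2 : Integrable (I.indicator fun _ => (1 : ℝ)) D := (integrable_const (1 : ℝ)).indicator hI
  unfold fluctuation
  rw [integral_sq_sum_predictable D (a := active I τ) (measurable_active hI τ) (abs_active_le I τ)
    (fun j k h => active_update h)
    (g := fun z => I.indicator (B.indicator fun _ => 1) z -
      (∫ z in I, B.indicator (fun _ => (1 : ℝ)) z ∂D) / D.real I *
        I.indicator (fun _ => (1 : ℝ)) z)
    ((((measurable_const).indicator hB).indicator hI).sub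
      ((measurable_indicator_one hI).const_mul _)) (abs_centred_le D hB)]
  · simp_rw [active_sq]
    refine mul_le_mul_of_nonneg_left ?_
      (Finset.sum_nonneg fun j _ => integral_nonneg fun ω => active_nonneg ..)
    rw [hm]
    set p := D.real (B ∩ I)
    have hexp : ∀ z, (I.indicator (B.indicator fun _ => (1 : ℝ)) z -
        p / D.real I * I.indicator (fun _ => (1 : ℝ)) z) ^ 2 =
        (B ∩ I).indicator (fun _ => (1 : ℝ)) z * (1 - 2 * (p / D.real I)) +
          (p / D.real I) ^ 2 * I.indicator (fun _ => (1 : ℝ)) z := by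
      intro z
      rw [hii]
      by_cases hz : z ∈ I <;> by_cases hzB : z ∈ B <;> simp [hz, hzB]; ring
    simp_rw [hexp]
    rw [integral_add, integral_mul_const, integral_const_mul, integral_indicator_one_eq D hI,
      integral_indicator_one_eq D (hB.inter hI)]
    -- The exact second moment is `p - p ^ 2 / D.real I`. Only the bound `p` is kept, because it is
    -- additive over disjoint sets `B`.
    · have : p * (1 - 2 * (p / D.real I)) + (p / D.real I) ^ 2 * D.real I =
          p - p ^ 2 / D.real I := by field_simp; ring
      have h2 : 0 ≤ p ^ 2 / D.real I := by positivity
      linarith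
    · exact ((integrable_const (1 : ℝ)).indicator (hB.inter hI)).mul_const _
    · exact hint2.const_mul _
  · rw [integral_sub hint1 (hint2.const_mul _), integral_const_mul, hm, hii,
      integral_indicator_one_eq D hI, integral_indicator_one_eq D (hB.inter hI)]
    field_simp
    ring

end Capped

/-! ### Uniform deviation bounds by two-level chaining -/

section Chaining

variable {Z : Type*} [MeasurableSpace Z] {M : ℕ} {D : Measure Z} {I : Set Z} {τ : ℝ}

theorem fluctuation_eq (φ : Z → ℝ) (ω : Fin M → Z) :
    fluctuation D I τ φ ω = ∑ j, active I τ j ω * I.indicator φ (ω j) -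
      (∫ z in I, φ z ∂D) / D.real I * keptHits I τ ω := by
  simp only [fluctuation, keptHits, mul_sub, Finset.sum_sub_distrib, Finset.mul_sum]
  congr 1
  exact Finset.sum_congr rfl fun j _ => by ring

theorem fluctuation_congr (hI : MeasurableSet I) {φ ψ : Z → ℝ} (h : Set.EqOn φ ψ I)
    (ω : Fin M → Z) : fluctuation D I τ φ ω = fluctuation D I τ ψ ω := by
  rw [fluctuation_eq, fluctuation_eq, setIntegral_congr_fun hI h]
  congr 1
  exact Finset.sum_congr rfl fun j _ => by rw [Set.indicator_congr h]

theorem fluctuation_add {φ ψ : Z → ℝ} (hφ : IntegrableOn φ I D) (hψ : IntegrableOn ψ I D)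
    (ω : Fin M → Z) : fluctuation D I τ (fun z => φ z + ψ z) ω =
      fluctuation D I τ φ ω + fluctuation D I τ ψ ω := by
  have h1 : I.indicator (fun z => φ z + ψ z) = fun z => I.indicator φ z + I.indicator ψ z :=
    Set.indicator_add I φ ψ
  simp only [fluctuation_eq, integral_add hφ hψ, h1, mul_add, Finset.sum_add_distrib, add_div]
  ring

theorem fluctuation_sum {ι : Type*} (T : Finset ι) (c : ι → ℝ) {φ : ι → Z → ℝ}
    (hφ : ∀ i ∈ T, IntegrableOn (φ i) I D) (ω : Fin M → Z) :
    fluctuation D I τ (fun z => ∑ i ∈ T, c i * φ i z) ω =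
      ∑ i ∈ T, c i * fluctuation D I τ (φ i) ω := by
  classical
  induction T using Finset.induction_on with
  | empty => simp [fluctuation]
  | insert a s ha ih =>
    have hs : ∀ i ∈ s, IntegrableOn (φ i) I D := fun i hi => hφ i (Finset.mem_insert_of_mem hi)
    have hfa := hφ a (Finset.mem_insert_self a s)
    have hca : fluctuation D I τ (fun z => c a * φ a z) ω = c a * fluctuation D I τ (φ a) ω := by
      have h1 : I.indicator (fun z => c a * φ a z) = fun z => c a * I.indicator (φ a) z :=
        funext fun z => by by_cases hz : z ∈ I <;> simp [hz]
      simp only [fluctuation_eq, integral_const_mul, h1, mul_sub, Finset.mul_sum]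
      congr 1
      · exact Finset.sum_congr rfl fun j _ => by ring
      · ring
    simp only [Finset.sum_insert ha]
    rw [fluctuation_add (hfa.const_mul _) (integrable_finsetSum _ fun i hi => (hs i hi).const_mul _),
      ih hs, hca]

theorem abs_fluctuation_le_mul_keptHits [IsFiniteMeasure D] (hq : 0 < D.real I) {φ : Z → ℝ}
    {c : ℝ} (hφ : ∀ z ∈ I, |φ z| ≤ c) (ω : Fin M → Z) :
    |fluctuation D I τ φ ω| ≤ 2 * c * keptHits I τ ω := by
  have h1 : |∑ j, active I τ j ω * I.indicator φ (ω j)| ≤ c * keptHits I τ ω := by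
    refine (Finset.abs_sum_le_sum_abs _ _).trans ?_
    rw [keptHits, Finset.mul_sum]
    refine Finset.sum_le_sum fun j _ => ?_
    rw [abs_mul, abs_of_nonneg (active_nonneg ..), mul_left_comm]
    refine mul_le_mul_of_nonneg_left ?_ (active_nonneg ..)
    by_cases h : ω j ∈ I
    · simpa [h] using hφ _ h
    · simp [h]
  have h2 : |(∫ z in I, φ z ∂D) / D.real I| ≤ c := by
    rw [abs_div, abs_of_pos hq, div_le_iff₀ hq]
    exact norm_setIntegral_le_of_norm_le_const (f := φ) (measure_lt_top D I) hφ
  rw [fluctuation_eq]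
  refine (abs_sub _ _).trans ?_
  rw [abs_mul, abs_of_nonneg (keptHits_nonneg I τ ω)]
  have := mul_le_mul_of_nonneg_right h2 (keptHits_nonneg I τ ω)
  linarith

/-- The fluctuation of a function that is constant on the classes of `idx` and bounded by `c` is at
most `c` times the sum of the absolute fluctuations of the indicators of the classes. -/
theorem fluctuation_of_const_on_classes [IsFiniteMeasure D] {ι : Type*} (hI : MeasurableSet I)
    {idx : Z → ι} {T : Finset ι}
    (hidx : ∀ B, MeasurableSet (idx ⁻¹' {B})) (hT : ∀ z ∈ I, idx z ∈ T) {φ : Z → ℝ} {c : ℝ}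
    (hφ : ∀ z ∈ I, |φ z| ≤ c) (hconst : ∀ z ∈ I, ∀ z' ∈ I, idx z = idx z' → φ z = φ z')
    (ω : Fin M → Z) :
    IntegrableOn φ I D ∧ |fluctuation D I τ φ ω| ≤
      c * ∑ B ∈ T, |fluctuation D I τ ((idx ⁻¹' {B}).indicator fun _ => 1) ω| := by
  classical
  rcases isEmpty_or_nonempty Z with hZ | hZ
  · rw [Set.eq_empty_of_isEmpty I]
    simp [fluctuation]
  -- `Φ B` is the value of `φ` on the class `B` inside `I`. It is arbitrary when the class misses
  -- `I`, but then the fluctuation of its indicator is zero.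
  set Φ : ι → ℝ := fun B => φ (Function.invFunOn idx I B) with hΦ
  have hB : ∀ B ∈ T, IntegrableOn ((idx ⁻¹' {B}).indicator fun _ => (1 : ℝ)) I D := fun B _ =>
    ((integrable_const (1 : ℝ)).indicator (hidx B)).integrableOn
  have heq : Set.EqOn φ (fun z => ∑ B ∈ T, Φ B * (idx ⁻¹' {B}).indicator (fun _ => 1) z) I := by
    intro z hz
    have hex : ∃ a ∈ I, idx a = idx z := ⟨z, hz, rfl⟩
    simp only
    rw [Finset.sum_eq_single (idx z)]
    · simp only [hΦ, Set.mem_preimage, Set.mem_singleton_iff, Set.indicator_of_mem, mul_one]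
      exact hconst z hz _ (Function.invFunOn_mem hex) (Function.invFunOn_eq hex).symm
    · intro B _ hne
      rw [Set.indicator_of_notMem, mul_zero]
      simpa using hne.symm
    · exact fun h => absurd (hT z hz) h
  constructor
  · refine IntegrableOn.congr_fun (?_ : IntegrableOn _ I D) heq.symm hI
    exact integrable_finsetSum _ fun B hB' => (hB B hB').const_mul _
  · rw [fluctuation_congr hI heq, fluctuation_sum T Φ hB, Finset.mul_sum]
    refine (Finset.abs_sum_le_sum_abs _ _).trans (Finset.sum_le_sum fun B _ => ?_)
    rw [abs_mul]
    by_cases hex : ∃ a ∈ I, idx a = B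
    · exact mul_le_mul_of_nonneg_right (hφ _ (Function.invFunOn_mem hex)) (abs_nonneg _)
    · have : fluctuation D I τ ((idx ⁻¹' {B}).indicator fun _ => 1) ω = 0 := by
        have h0 : Set.EqOn ((idx ⁻¹' {B}).indicator fun _ => (1 : ℝ)) (fun _ => 0) I := by
          intro z hz
          rw [Set.indicator_of_notMem]
          exact fun h => hex ⟨z, hz, h⟩
        rw [fluctuation_congr hI h0]
        simp [fluctuation]
      simp [this]

/-- Two-level chaining: the fluctuation of `h` in terms of those of the indicators of the fine
and the coarse classes. -/
theorem abs_fluctuation_le [IsFiniteMeasure D] {ι κ : Type*} (hI : MeasurableSet I)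
    (hq : 0 < D.real I)
    {idx : Z → ι} {π : ι → κ} {T : Finset ι} {T' : Finset κ}
    (hidx : ∀ B, MeasurableSet (idx ⁻¹' {B})) (hT : ∀ z ∈ I, idx z ∈ T)
    (hidx' : ∀ B, MeasurableSet ((fun z => π (idx z)) ⁻¹' {B})) (hT' : ∀ z ∈ I, π (idx z) ∈ T')
    {h : Z → ℝ} (hh : IntegrableOn h I D) {δ δ' : ℝ} (h1 : ∀ z ∈ I, |h z| ≤ 1)
    (hf : ∀ z ∈ I, ∀ z' ∈ I, idx z = idx z' → |h z - h z'| ≤ δ)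
    (hc : ∀ z ∈ I, ∀ z' ∈ I, π (idx z) = π (idx z') → |h z - h z'| ≤ δ') (ω : Fin M → Z) :
    |fluctuation D I τ h ω| ≤ 2 * δ * keptHits I τ ω +
      δ' * ∑ B ∈ T, |fluctuation D I τ ((idx ⁻¹' {B}).indicator fun _ => 1) ω| +
      ∑ B ∈ T', |fluctuation D I τ (((fun z => π (idx z)) ⁻¹' {B}).indicator fun _ => 1) ω| := by
  have hIne : I.Nonempty := by
    rw [Set.nonempty_iff_ne_empty]; rintro rfl; simp at hq
  have : Nonempty Z := ⟨hIne.some⟩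
  -- `ρ` and `ρ'` send a point to a representative in `I` of its fine and coarse class. The chain is
  -- `h = (h - h ∘ ρ) + (h ∘ ρ - h ∘ ρ') + h ∘ ρ'`; the middle link is small and constant on fine
  -- classes, the last is bounded and constant on coarse ones.
  set ρ : Z → Z := fun z => Function.invFunOn idx I (idx z) with hρ
  set ρ' : Z → Z := fun z => Function.invFunOn (fun z => π (idx z)) I (π (idx z)) with hρ'
  have hρI : ∀ z ∈ I, ρ z ∈ I ∧ idx (ρ z) = idx z := fun z hz =>
    ⟨Function.invFunOn_mem ⟨z, hz, rfl⟩, Function.invFunOn_eq (f := idx) ⟨z, hz, rfl⟩⟩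
  have hρI' : ∀ z ∈ I, ρ' z ∈ I ∧ π (idx (ρ' z)) = π (idx z) := fun z hz =>
    ⟨Function.invFunOn_mem (f := fun z => π (idx z)) ⟨z, hz, rfl⟩,
      Function.invFunOn_eq (f := fun z => π (idx z)) ⟨z, hz, rfl⟩⟩
  obtain ⟨i1, b1⟩ := fluctuation_of_const_on_classes (D := D) (τ := τ) hI hidx' hT'
    (φ := fun z => h (ρ' z)) (c := 1) (fun z hz => h1 _ (hρI' z hz).1)
    (fun z _ z' _ hzz => by simp only [hρ', hzz]) ω
  obtain ⟨i2, b2⟩ := fluctuation_of_const_on_classes (D := D) (τ := τ) hI hidx hT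
    (φ := fun z => h (ρ z) - h (ρ' z)) (c := δ')
    (fun z hz => hc _ (hρI z hz).1 _ (hρI' z hz).1 (by rw [(hρI z hz).2, (hρI' z hz).2]))
    (fun z _ z' _ hzz => by simp only [hρ, hρ', hzz]) ω
  have b3 := abs_fluctuation_le_mul_keptHits (τ := τ) hq (φ := fun z => h z - h (ρ z)) (c := δ)
    (fun z hz => hf z hz _ (hρI z hz).1 (hρI z hz).2.symm) ω
  have i3 : IntegrableOn (fun z => h z - h (ρ z)) I D := by
    have : (fun z => h z - h (ρ z)) = fun z => h z - ((h (ρ z) - h (ρ' z)) + h (ρ' z)) := by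
      ext z; ring
    rw [this]
    exact hh.sub (i2.add i1)
  have hsplit : fluctuation D I τ h ω = fluctuation D I τ (fun z => h z - h (ρ z)) ω +
      (fluctuation D I τ (fun z => h (ρ z) - h (ρ' z)) ω +
        fluctuation D I τ (fun z => h (ρ' z)) ω) := by
    rw [← fluctuation_add i2 i1, ← fluctuation_add (ψ := fun z => h (ρ z) - h (ρ' z) + h (ρ' z)) i3
      (i2.add i1)]
    congr 1; ext z; ring
  rw [hsplit]
  refine (abs_add_le _ _).trans ?_
  have := abs_add_le (fluctuation D I τ (fun z => h (ρ z) - h (ρ' z)) ω)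
    (fluctuation D I τ (fun z => h (ρ' z)) ω)
  linarith

/-- If `h` has nonpositive sum over the kept samples in `I`, then its integral over `I` is small. -/
theorem setIntegral_le_of_sum_nonpos [IsFiniteMeasure D] (hq : 0 < D.real I) {t ν : ℝ}
    (ht : 0 < t) (hν : 0 < ν) (htτ : t ≤ τ) (htν : t ≤ ν / 2) {h : Z → ℝ}
    (h1 : ∀ z ∈ I, |h z| ≤ 1) {ω : Fin M → Z}
    (hsum : ∑ j, active I τ j ω * I.indicator h (ω j) ≤ 0) :
    ∫ z in I, h z ∂D ≤ D.real I / t *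
      (|fluctuation D I τ h ω| + (hits I ω - ν) ^ 2 / (2 * ν)) := by
  set U := ∫ z in I, h z ∂D with hU
  set V := (hits I ω - ν) ^ 2 / (2 * ν)
  have hV : 0 ≤ V := by positivity
  rcases le_or_gt U 0 with hU0 | hU0
  · exact hU0.trans (by positivity)
  have hUq : U / D.real I ≤ 1 := by
    rw [div_le_one hq]
    have := norm_setIntegral_le_of_norm_le_const (f := h) (measure_lt_top D I) h1
    rw [one_mul] at this
    exact (le_abs_self _).trans this
  have hUq0 : 0 < U / D.real I := div_pos hU0 hq
  have hfl := fluctuation_eq (D := D) (I := I) (τ := τ) h ω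
  rw [← hU] at hfl
  -- The fluctuation is the nonpositive sample sum minus `U / D.real I * keptHits`, so the latter
  -- product is at most its absolute value.
  have h2 : U / D.real I * keptHits I τ ω ≤ |fluctuation D I τ h ω| := by
    have := neg_le_abs (fluctuation D I τ h ω)
    linarith
  -- A shortfall of kept samples below `t` is paid for by `V`, since the mean `U / D.real I` is at
  -- most `1`.
  have h3 : (t - keptHits I τ ω) * (U / D.real I) ≤ V := by
    have h4 := sub_keptHits_le I hν htτ htν ω
    calc (t - keptHits I τ ω) * (U / D.real I) ≤ V * (U / D.real I) :=
          mul_le_mul_of_nonneg_right h4 hUq0.le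
      _ ≤ V := mul_le_of_le_one_right hV hUq
  have h5 : t * (U / D.real I) ≤ |fluctuation D I τ h ω| + V := by linarith
  calc U = D.real I / t * (t * (U / D.real I)) := by field_simp
    _ ≤ _ := mul_le_mul_of_nonneg_left h5 (by positivity)

/-- Cauchy–Schwarz in additive form, with a free weight `θ`. The right side is linear in the sum of
squares, so expectations can be taken termwise. -/
theorem sum_abs_le {ι : Type*} (T : Finset ι) (w : ι → ℝ) {θ : ℝ} (hθ : 0 < θ) :
    ∑ B ∈ T, |w B| ≤ θ * T.card / 2 + (∑ B ∈ T, w B ^ 2) / (2 * θ) := by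
  have : ∀ B ∈ T, |w B| ≤ θ / 2 + w B ^ 2 / (2 * θ) := fun B _ => by
    have h : θ / 2 + w B ^ 2 / (2 * θ) - |w B| = (θ - |w B|) ^ 2 / (2 * θ) := by
      field_simp; rw [sub_sq, sq_abs]; ring
    have : 0 ≤ (θ - |w B|) ^ 2 / (2 * θ) := by positivity
    linarith
  refine (Finset.sum_le_sum this).trans (le_of_eq ?_)
  rw [Finset.sum_add_distrib, Finset.sum_const, Finset.sum_div, nsmul_eq_mul]
  ring

/-! ### Expected excess error on one cell -/

/-- The sum of the squared fluctuations of the indicators of the classes of `idx`. -/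
def squareSum (D : Measure Z) (I : Set Z) (τ : ℝ) {ι : Type*} (idx : Z → ι) (T : Finset ι)
    (ω : Fin M → Z) : ℝ :=
  ∑ B ∈ T, fluctuation D I τ ((idx ⁻¹' {B}).indicator fun _ => 1) ω ^ 2

theorem squareSum_nonneg {ι : Type*} (idx : Z → ι) (T : Finset ι) (ω : Fin M → Z) :
    0 ≤ squareSum D I τ idx T ω := Finset.sum_nonneg fun _ _ => sq_nonneg _

theorem measurable_squareSum {ι : Type*} (hI : MeasurableSet I) {idx : Z → ι}
    (hidx : ∀ B, MeasurableSet (idx ⁻¹' {B})) (T : Finset ι) :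
    Measurable (squareSum D I τ idx T : (Fin M → Z) → ℝ) :=
  Finset.measurable_sum _ fun B _ =>
    (measurable_fluctuation hI τ (measurable_const.indicator (hidx B))).pow_const 2

theorem integrable_sq_fluctuation [IsProbabilityMeasure D] (hI : MeasurableSet I)
    {B : Set Z} (hB : MeasurableSet B) :
    Integrable (fun ω => fluctuation D I τ (B.indicator fun _ => 1) ω ^ 2)
      (Measure.pi fun _ : Fin M => D) := by
  refine integrable_of_abs_le (c := (M : ℝ) ^ 2)
    ((measurable_fluctuation hI τ (measurable_const.indicator hB)).pow_const 2) fun ω => ?_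
  rw [abs_pow]
  refine pow_le_pow_left₀ (abs_nonneg _) ?_ 2
  refine (Finset.abs_sum_le_sum_abs _ _).trans ?_
  refine (Finset.sum_le_card_nsmul _ _ 1 fun j _ => ?_).trans (by simp)
  rw [abs_mul]
  exact mul_le_one₀ (abs_active_le I τ j ω) (abs_nonneg _) (abs_centred_le D hB (ω j))

theorem integrable_squareSum [IsProbabilityMeasure D] {ι : Type*} (hI : MeasurableSet I)
    {idx : Z → ι} (hidx : ∀ B, MeasurableSet (idx ⁻¹' {B})) (T : Finset ι) :
    Integrable (squareSum D I τ idx T) (Measure.pi fun _ : Fin M => D) :=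
  integrable_finsetSum _ fun B _ => integrable_sq_fluctuation hI (hidx B)

/-- Each class contributes at most the expected number of active times multiplied by its mass in
`I`. The classes are disjoint, so the masses add up to at most `D.real I`, and `integral_keptHits`
identifies the product. The number of classes plays no role. -/
theorem integral_squareSum_le [IsProbabilityMeasure D] {ι : Type*} (hI : MeasurableSet I)
    (hq : 0 < D.real I)
    {idx : Z → ι} (hidx : ∀ B, MeasurableSet (idx ⁻¹' {B})) (T : Finset ι) :
    ∫ ω, squareSum D I τ idx T ω ∂(Measure.pi fun _ : Fin M => D) ≤
      ∫ ω, keptHits I τ ω ∂(Measure.pi fun _ : Fin M => D) := by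
  unfold squareSum
  rw [integral_finsetSum _ fun B _ => integrable_sq_fluctuation hI (hidx B),
    integral_keptHits D hI]
  refine (Finset.sum_le_sum fun B _ => integral_sq_fluctuation_le D hI τ hq (hidx B)).trans ?_
  rw [← Finset.mul_sum]
  refine mul_le_mul_of_nonneg_left ?_
    (Finset.sum_nonneg fun j _ => integral_nonneg fun ω => active_nonneg ..)
  rw [← measureReal_biUnion_finset]
  · exact measureReal_mono (Set.iUnion₂_subset fun B _ => Set.inter_subset_right)
  · intro B _ B' _ hne
    refine Set.disjoint_left.2 fun z hz hz' => hne ?_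
    exact hz.1.symm.trans hz'.1
  · exact fun B _ => (hidx B).inter hI

/-- A bound for the excess error of an empirical risk minimizer on the cell `I`, as a function of
the samples. -/
def excessBound (D : Measure Z) (I : Set Z) (τ t : ℝ) (K J : ℕ) (idx : Z → ℕ × ℕ)
    (T T' : Finset (ℕ × ℕ)) (ω : Fin M → Z) : ℝ :=
  D.real I / t * (8 / (J : ℝ) ^ 2 * keptHits I τ ω +
    (2 * K * T.card / (J : ℝ) ^ 2 + 2 * squareSum D I τ idx T ω / K) +
    (K * T'.card / 2 + squareSum D I τ (fun z => ((idx z).1 / J, (idx z).2 / J)) T' ω / (2 * K)) +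
    (hits I ω - M * D.real I) ^ 2 / (2 * (M * D.real I)))

/-- `h` may depend on `ω`, whereas the right side involves no `h`. This gives the uniformity needed
for a data-dependent minimizer. -/
theorem setIntegral_le_excessBound [IsProbabilityMeasure D] (hI : MeasurableSet I)
    (hq : 0 < D.real I) (hM : 0 < M) {t : ℝ} (ht : 0 < t) (htτ : t ≤ τ)
    (htν : t ≤ M * D.real I / 2) {K J : ℕ} (hK : 0 < K) (hJ : 0 < J) {idx : Z → ℕ × ℕ}
    {T T' : Finset (ℕ × ℕ)} (hidx : Measurable idx) (hT : ∀ z ∈ I, idx z ∈ T)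
    (hT' : ∀ z ∈ I, ((idx z).1 / J, (idx z).2 / J) ∈ T') {h : Z → ℝ} (hh : IntegrableOn h I D)
    (h1 : ∀ z ∈ I, |h z| ≤ 1)
    (hf : ∀ z ∈ I, ∀ z' ∈ I, idx z = idx z' → |h z - h z'| ≤ 4 / (J : ℝ) ^ 2)
    (hc : ∀ z ∈ I, ∀ z' ∈ I, ((idx z).1 / J, (idx z).2 / J) = ((idx z').1 / J, (idx z').2 / J) →
      |h z - h z'| ≤ 4 / J)
    {ω : Fin M → Z} (hsum : ∑ j, active I τ j ω * I.indicator h (ω j) ≤ 0) :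
    ∫ z in I, h z ∂D ≤ excessBound D I τ t K J idx T T' ω := by
  have hM' : (0 : ℝ) < M := Nat.cast_pos.2 hM
  have hK' : (0 : ℝ) < K := Nat.cast_pos.2 hK
  have hJ' : (0 : ℝ) < J := Nat.cast_pos.2 hJ
  refine (setIntegral_le_of_sum_nonpos hq ht (mul_pos hM' hq) htτ htν h1 hsum).trans ?_
  refine mul_le_mul_of_nonneg_left (add_le_add ?_ le_rfl) (by positivity)
  refine (abs_fluctuation_le (π := fun p : ℕ × ℕ => (p.1 / J, p.2 / J)) hI hq
    (fun B => hidx (measurableSet_singleton B)) hT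
    (fun B => ((measurable_of_countable fun p : ℕ × ℕ => (p.1 / J, p.2 / J)).comp hidx)
      (measurableSet_singleton B)) hT' hh h1 hf hc ω).trans ?_
  -- The weights `K / J` and `K` make the square-sum terms at most of order `t / K` in expectation.
  -- The chaining factor `4 / J` turns the first cardinality term into `2 * K * T.card / J ^ 2`.
  have e1 := sum_abs_le T (fun B => fluctuation D I τ ((idx ⁻¹' {B}).indicator fun _ => 1) ω)
    (θ := K / J) (by positivity)
  have e2 := sum_abs_le T' (fun B => fluctuation D I τ
    (((fun z => ((idx z).1 / J, (idx z).2 / J)) ⁻¹' {B}).indicator fun _ => 1) ω)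
    (θ := K) (by positivity)
  refine add_le_add (add_le_add (le_of_eq (by ring)) ?_) e2
  refine (mul_le_mul_of_nonneg_left e1 (by positivity)).trans (le_of_eq ?_)
  unfold squareSum
  field_simp
  ring

theorem excessBound_nonneg {t : ℝ} (ht : 0 ≤ t) (K J : ℕ) (idx : Z → ℕ × ℕ)
    (T T' : Finset (ℕ × ℕ)) (ω : Fin M → Z) : 0 ≤ excessBound D I τ t K J idx T T' ω := by
  have h1 := keptHits_nonneg I τ ω
  have h2 := squareSum_nonneg (D := D) (I := I) (τ := τ) idx T ω
  have h3 := squareSum_nonneg (D := D) (I := I) (τ := τ)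
    (fun z => ((idx z).1 / J, (idx z).2 / J)) T' ω
  unfold excessBound
  positivity

theorem measurable_coarse {idx : Z → ℕ × ℕ} (hidx : Measurable idx) (J : ℕ) :
    Measurable fun z => ((idx z).1 / J, (idx z).2 / J) :=
  (measurable_of_countable fun p : ℕ × ℕ => (p.1 / J, p.2 / J)).comp hidx

theorem measurable_excessBound (hI : MeasurableSet I) (t : ℝ) (K J : ℕ) {idx : Z → ℕ × ℕ}
    (hidx : Measurable idx) (T T' : Finset (ℕ × ℕ)) :
    Measurable (excessBound D I τ t K J idx T T' : (Fin M → Z) → ℝ) := by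
  have h1 := measurable_keptHits (M := M) hI τ
  have h2 := measurable_squareSum (M := M) (D := D) (τ := τ) hI
    (fun B => hidx (measurableSet_singleton B)) T
  have h3 := measurable_squareSum (M := M) (D := D) (τ := τ) hI
    (fun B => measurable_coarse hidx J (measurableSet_singleton B)) T'
  have h4 := measurable_hits (M := M) hI
  unfold excessBound
  fun_prop

theorem integrable_sq_hits_sub [IsProbabilityMeasure D] (hI : MeasurableSet I) :
    Integrable (fun ω => (hits I ω - M * D.real I) ^ 2) (Measure.pi fun _ : Fin M => D) := by
  refine integrable_of_abs_le (c := (M : ℝ) ^ 2)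
    (((measurable_hits hI).sub_const _).pow_const 2) fun ω => ?_
  have a1 := hits_nonneg I ω
  have a2 := hits_le I ω
  have a3 : (M : ℝ) * D.real I ≤ M :=
    mul_le_of_le_one_right (Nat.cast_nonneg _) measureReal_le_one
  have a4 : 0 ≤ (M : ℝ) * D.real I := by positivity
  rw [abs_pow]
  refine pow_le_pow_left₀ (abs_nonneg _) ?_ 2
  rw [abs_le]; constructor <;> linarith

theorem integrable_excessBound [IsProbabilityMeasure D] (hI : MeasurableSet I) (t : ℝ) (K J : ℕ)
    {idx : Z → ℕ × ℕ} (hidx : Measurable idx) (T T' : Finset (ℕ × ℕ)) :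
    Integrable (excessBound D I τ t K J idx T T') (Measure.pi fun _ : Fin M => D) := by
  have h2 := integrable_squareSum (M := M) (D := D) (τ := τ) hI
    (fun B => hidx (measurableSet_singleton B)) T
  have h3 := integrable_squareSum (M := M) (D := D) (τ := τ) hI
    (fun B => measurable_coarse hidx J (measurableSet_singleton B)) T'
  exact (((((integrable_keptHits D hI τ).const_mul _).add
    ((integrable_const _).add ((h2.const_mul 2).div_const _))).add
    ((integrable_const _).add (h3.div_const _))).add ((integrable_sq_hits_sub hI).div_const _)).const_mul _

/-- The expected number of kept samples is at most `2 * t`. The terms proportional to it give `(16 +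
4 + 1) * t / K`, and dividing by `t` leaves `21 / K` per unit mass. The remaining terms do not grow
with the number of samples. -/
theorem integral_excessBound_le [IsProbabilityMeasure D] (hI : MeasurableSet I)
    (hq : 0 < D.real I) (hM : 0 < M) (hτ : 1 ≤ τ) {K J : ℕ} (hK : 0 < K) (hJ : K ≤ J ^ 2)
    {idx : Z → ℕ × ℕ} (hidx : Measurable idx) (T T' : Finset (ℕ × ℕ)) :
    ∫ ω, excessBound D I τ (min (M * D.real I / 2) τ) K J idx T T' ω
        ∂(Measure.pi fun _ : Fin M => D) ≤
      21 * D.real I / K + (2 / M + D.real I / τ) *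
        (2 * K * T.card / (J : ℝ) ^ 2 + K * T'.card / 2 + 1 / 2) := by
  have hM' : (0 : ℝ) < M := Nat.cast_pos.2 hM
  have hK' : (0 : ℝ) < K := Nat.cast_pos.2 hK
  have hKJ : (K : ℝ) ≤ (J : ℝ) ^ 2 := by exact_mod_cast hJ
  have hν : 0 < M * D.real I := mul_pos hM' hq
  set t := min (M * D.real I / 2) τ with ht
  have ht0 : 0 < t := lt_min (by positivity) (by linarith)
  have i1 := integrable_keptHits (M := M) D hI τ
  have i2 := integrable_squareSum (M := M) (D := D) (τ := τ) hI
    (fun B => hidx (measurableSet_singleton B)) T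
  have i3 := integrable_squareSum (M := M) (D := D) (τ := τ) hI
    (fun B => measurable_coarse hidx J (measurableSet_singleton B)) T'
  have i4 := integrable_sq_hits_sub (M := M) (D := D) hI
  set e := ∫ ω, keptHits I τ ω ∂(Measure.pi fun _ : Fin M => D) with he
  have he2 : e ≤ 2 * t := by
    have := integral_keptHits_le (M := M) D hI (τ := τ) (by linarith)
    have h1 := this.trans (min_le_left _ _)
    have h2 := this.trans (min_le_right _ _)
    have h3 : e / 2 ≤ t := le_min (by linarith) (by linarith)
    linarith
  have q2 := integral_squareSum_le (M := M) (D := D) (τ := τ) hI hq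
    (fun B => hidx (measurableSet_singleton B)) T
  have q3 := integral_squareSum_le (M := M) (D := D) (τ := τ) hI hq
    (fun B => measurable_coarse hidx J (measurableSet_singleton B)) T'
  have q4 := integral_sq_hits_sub_le (M := M) D hI
  unfold excessBound
  rw [integral_const_mul, integral_add, integral_add, integral_add, integral_const_mul,
    integral_add (integrable_const _) ((i2.const_mul 2).div_const _),
    integral_add (integrable_const _) (i3.div_const _)]
  rotate_left
  · exact i1.const_mul _
  · exact (integrable_const _).add ((i2.const_mul 2).div_const _)
  · exact (i1.const_mul _).add ((integrable_const _).add ((i2.const_mul 2).div_const _))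
  · exact (integrable_const _).add (i3.div_const _)
  · exact ((i1.const_mul _).add ((integrable_const _).add ((i2.const_mul 2).div_const _))).add
      ((integrable_const _).add (i3.div_const _))
  · exact i4.div_const _
  simp only [integral_const, probReal_univ, one_smul, integral_div, integral_const_mul]
  rw [← he] at q2 q3 ⊢
  set Q2 := ∫ ω, squareSum D I τ idx T ω ∂(Measure.pi fun _ : Fin M => D)
  set Q3 := ∫ ω, squareSum D I τ (fun z => ((idx z).1 / J, (idx z).2 / J)) T' ω
    ∂(Measure.pi fun _ : Fin M => D)
  have b1 : 8 / (J : ℝ) ^ 2 * e ≤ 16 * t / K := by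
    calc 8 / (J : ℝ) ^ 2 * e ≤ 8 / (J : ℝ) ^ 2 * (2 * t) :=
          mul_le_mul_of_nonneg_left he2 (by positivity)
      _ ≤ 8 / (K : ℝ) * (2 * t) :=
          mul_le_mul_of_nonneg_right (div_le_div_of_nonneg_left (by norm_num) hK' hKJ)
            (by positivity)
      _ = _ := by ring
  have b2 : 2 * Q2 / K ≤ 4 * t / K :=
    div_le_div_of_nonneg_right (by linarith) hK'.le
  have b3 : Q3 / (2 * K) ≤ t / K := by
    rw [div_le_div_iff₀ (by positivity) hK']
    nlinarith [q3.trans he2]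
  have b4 : (∫ ω, (hits I ω - M * D.real I) ^ 2 ∂(Measure.pi fun _ : Fin M => D)) /
      (2 * (M * D.real I)) ≤ 1 / 2 := by
    rw [div_le_iff₀ (by positivity)]
    linarith
  set s := 2 * K * T.card / (J : ℝ) ^ 2 + K * T'.card / 2 + 1 / 2 with hs
  have hs0 : 0 ≤ s := by positivity
  -- The two alternatives of the minimum, a sparse cell and a capped cell, are replaced by their sum
  -- so that the bound can be summed over cells.
  have hqt : D.real I / t ≤ 2 / M + D.real I / τ := by
    rcases min_choice (M * D.real I / 2) τ with h | h
    · have : D.real I / t = 2 / M := by rw [ht, h]; field_simp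
      rw [this]
      have : 0 ≤ D.real I / τ := by positivity
      linarith
    · rw [ht, h]
      have : 0 ≤ 2 / (M : ℝ) := by positivity
      linarith
  calc _ ≤ D.real I / t * (21 * t / K + s) := by
        refine mul_le_mul_of_nonneg_left ?_ (by positivity)
        have : 16 * t / K + 4 * t / K + t / K = 21 * t / K := by ring
        rw [hs]; linarith
    _ = 21 * D.real I / K + D.real I / t * s := by field_simp
    _ ≤ _ := by gcongr

end Chaining

/-! ### The partition -/

section Partition

variable {L : ℝ} {K m : ℕ}

theorem rawBreak_odd (L : ℝ) (K m k : ℕ) :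
    rawBreak L K m (2 * k + 1) = ((m : ℝ) + k * (K + 1)) / L := by
  induction k with
  | zero => simp [rawBreak]
  | succ k ih =>
    have h1 : 2 * (k + 1) + 1 = (2 * k + 1 + 1) + 1 := by ring
    have h2 : Even (2 * k + 1 + 1) := ⟨k + 1, by ring⟩
    have h3 : ¬ Even (2 * k + 1) := by simp
    rw [h1, rawBreak, if_neg (by omega), if_pos h2, rawBreak, if_neg (by omega), if_neg h3, ih]
    push_cast
    ring

theorem rawBreak_even (L : ℝ) (K m k : ℕ) :
    rawBreak L K m (2 * k + 2) = ((m : ℝ) + k * (K + 1) + 1) / L := by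
  have h3 : ¬ Even (2 * k + 1) := by simp
  rw [rawBreak, rawBreak_odd, if_neg (by omega), if_neg h3]
  ring

theorem rawBreak_lt_succ (hL : 0 < L) (hK : 0 < K) (hm : 0 < m) (n : ℕ) :
    rawBreak L K m n < rawBreak L K m (n + 1) := by
  have hm' : (0 : ℝ) < m := Nat.cast_pos.2 hm
  have hK' : (0 : ℝ) < K := Nat.cast_pos.2 hK
  rw [rawBreak]
  split_ifs <;> simp only [lt_add_iff_pos_right] <;> positivity

theorem rawBreak_nonneg (hL : 0 < L) (hK : 0 < K) (hm : 0 < m) (n : ℕ) :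
    0 ≤ rawBreak L K m n :=
  (strictMono_nat_of_lt_succ (rawBreak_lt_succ hL hK hm)).monotone (Nat.zero_le n)

theorem coe_breakpoint (hL : 0 < L) (hK : 0 < K) (hm : 0 < m) (n : ℕ) :
    (breakpoint L K m n : ℝ) = min 1 (rawBreak L K m n) := by
  rw [breakpoint, Set.coe_projIcc, max_eq_right]
  exact le_min zero_le_one (rawBreak_nonneg hL hK hm n)

theorem breakpoint_lt_one_iff (hL : 0 < L) (hK : 0 < K) (hm : 0 < m) {n : ℕ} :
    breakpoint L K m n < 1 ↔ rawBreak L K m n < 1 := by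
  rw [← Subtype.coe_lt_coe, coe_breakpoint hL hK hm]
  simp

theorem coe_breakpoint_of_lt (hL : 0 < L) (hK : 0 < K) (hm : 0 < m) {n : ℕ}
    (h : breakpoint L K m n < 1) : (breakpoint L K m n : ℝ) = rawBreak L K m n := by
  rw [coe_breakpoint hL hK hm, min_eq_right ((breakpoint_lt_one_iff hL hK hm).1 h).le]

theorem coe_breakpoint_le (hL : 0 < L) (hK : 0 < K) (hm : 0 < m) (n : ℕ) :
    (breakpoint L K m n : ℝ) ≤ rawBreak L K m n := by
  rw [coe_breakpoint hL hK hm]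
  exact min_le_right _ _

theorem breakpoint_zero : breakpoint L K m 0 = 0 := by
  ext; simp [breakpoint, rawBreak]

theorem monotone_breakpoint (hL : 0 < L) (hK : 0 < K) (hm : 0 < m) :
    Monotone (breakpoint L K m) := fun _ _ h =>
  Set.monotone_projIcc _ ((strictMono_nat_of_lt_succ (rawBreak_lt_succ hL hK hm)).monotone h)

theorem breakpoint_lt_succ (hL : 0 < L) (hK : 0 < K) (hm : 0 < m) {n : ℕ}
    (h : breakpoint L K m n < 1) : breakpoint L K m n < breakpoint L K m (n + 1) := by
  rw [← Subtype.coe_lt_coe, coe_breakpoint_of_lt hL hK hm h, coe_breakpoint hL hK hm]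
  exact lt_min ((breakpoint_lt_one_iff hL hK hm).1 h) (rawBreak_lt_succ hL hK hm n)

theorem exists_breakpoint_eq_one (hL : 0 < L) (hK : 0 < K) (hm : 0 < m) :
    ∃ n, breakpoint L K m n = 1 := by
  obtain ⟨k, hk⟩ := exists_nat_ge L
  refine ⟨2 * k + 1, ?_⟩
  by_contra hne
  have h := (breakpoint_lt_one_iff hL hK hm).1 (lt_of_le_of_ne unitInterval.le_one' hne)
  rw [rawBreak_odd, div_lt_one hL] at h
  have hk0 : (0 : ℝ) ≤ k := Nat.cast_nonneg _
  have hK0 : (0 : ℝ) ≤ K := Nat.cast_nonneg _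
  have hm0 : (0 : ℝ) ≤ m := Nat.cast_nonneg _
  nlinarith [mul_nonneg hk0 hK0]

theorem breakpoint_one_pos (hL : 0 < L) (hK : 0 < K) (hm : 0 < m) {n : ℕ} (hn : 0 < n) :
    0 < breakpoint L K m n := by
  have h := breakpoint_lt_succ hL hK hm (n := 0) (by rw [breakpoint_zero]; exact zero_lt_one)
  rw [breakpoint_zero] at h
  exact h.trans_le (monotone_breakpoint hL hK hm hn)

theorem short_length (hL : 0 < L) (hK : 0 < K) (hm : 0 < m) {i : ℕ} (hi : Odd i)
    (h : breakpoint L K m (i + 1) < 1) :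
    (breakpoint L K m (i + 1) : ℝ) - breakpoint L K m i = 1 / L := by
  obtain ⟨k, rfl⟩ := hi
  have h' : breakpoint L K m (2 * k + 1) < 1 :=
    (monotone_breakpoint hL hK hm (Nat.le_succ _)).trans_lt h
  rw [coe_breakpoint_of_lt hL hK hm h, coe_breakpoint_of_lt hL hK hm h', rawBreak_even,
    rawBreak_odd]
  ring

/-- Adjacent cells share an end point, but two cells of equal parity have a cell of positive length
between them. Uniqueness therefore holds only within a parity. -/
theorem cell_index_unique (hL : 0 < L) (hK : 0 < K) (hm : 0 < m) {i i' : ℕ} {x : unitInterval}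
    (hpar : Even i ↔ Even i') (hi : x ∈ cell (breakpoint L K m) i)
    (hi' : x ∈ cell (breakpoint L K m) i') : i = i' := by
  have key : ∀ i i' : ℕ, (Even i ↔ Even i') → x ∈ cell (breakpoint L K m) i →
      x ∈ cell (breakpoint L K m) i' → i ≤ i' → i = i' := by
    intro i i' hpar hi hi' hle
    by_contra hne
    have h2 : i + 2 ≤ i' := by
      have : i' ≠ i + 1 := by
        rintro rfl
        rw [Nat.even_add_one] at hpar
        tauto
      omega
    have hmono := monotone_breakpoint hL hK hm
    have h3 : breakpoint L K m (i + 1) ≤ breakpoint L K m i' := hmono (by omega)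
    have h4 := breakpoint_lt_succ hL hK hm (h3.trans_lt hi'.1)
    exact absurd (h4.trans_le (hmono h2)) (not_lt.2 (hi'.2.1.trans hi.2.2))
  rcases le_total i i' with h | h
  · exact key i i' hpar hi hi' h
  · exact (key i' i hpar.symm hi' hi h).symm

theorem exists_mem_cell (hL : 0 < L) (hK : 0 < K) (hm : 0 < m) (x : unitInterval) :
    ∃ i, x ∈ cell (breakpoint L K m) i := by
  have hex : ∃ n, x ≤ breakpoint L K m n := by
    obtain ⟨n, hn⟩ := exists_breakpoint_eq_one (L := L) (K := K) (m := m) hL hK hm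
    exact ⟨n, hn ▸ unitInterval.le_one'⟩
  classical
  rcases h : Nat.find hex with _ | n
  · have h0 := Nat.find_spec hex
    rw [h, breakpoint_zero] at h0
    refine ⟨0, ?_, ?_, h0.trans unitInterval.nonneg'⟩ <;> rw [breakpoint_zero]
    · exact zero_lt_one
    · exact unitInterval.nonneg'
  · have h1 : breakpoint L K m n < x := not_le.1 (Nat.find_min hex (m := n) (by omega))
    exact ⟨n, h1.trans_le unitInterval.le_one', h1.le, h ▸ Nat.find_spec hex⟩

theorem lt_of_mem_long_cell (hL : 0 < L) (hK : 0 < K) (hm : 0 < m) {k : ℕ}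
    (h : breakpoint L K m (2 * k) < 1) : k < ⌈L / K⌉₊ + 1 := by
  rcases k with _ | k
  · omega
  · have hK' : (0 : ℝ) < K := Nat.cast_pos.2 hK
    have h1 := (breakpoint_lt_one_iff hL hK hm).1 h
    rw [show 2 * (k + 1) = 2 * k + 2 by ring, rawBreak_even, div_lt_one hL] at h1
    have h2 : (k : ℝ) < L / K := by
      rw [lt_div_iff₀ hK']
      have hm0 : (0 : ℝ) ≤ m := Nat.cast_nonneg _
      have hk0 : (0 : ℝ) ≤ k := Nat.cast_nonneg _
      linarith
    have h3 : (k : ℝ) < (⌈L / K⌉₊ : ℕ) := h2.trans_le (Nat.le_ceil _)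
    have := Nat.cast_lt.1 h3
    omega

/-- The length of the `k`-th long interval, in units of `1 / L`. -/
def longLength (L : ℝ) (K m k : ℕ) : ℝ :=
  L * ((breakpoint L K m (2 * k + 1) : ℝ) - breakpoint L K m (2 * k))

theorem longLength_nonneg (hL : 0 < L) (hK : 0 < K) (hm : 0 < m) (k : ℕ) :
    0 ≤ longLength L K m k :=
  mul_nonneg hL.le (sub_nonneg.2 (monotone_breakpoint hL hK hm (Nat.le_succ _)))

theorem longLength_le (hL : 0 < L) (hK : 0 < K) (hm : 0 < m) (hmK : m ≤ K) {k : ℕ}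
    (h : breakpoint L K m (2 * k) < 1) : longLength L K m k ≤ K := by
  have hle := coe_breakpoint_le (L := L) (K := K) (m := m) hL hK hm (2 * k + 1)
  have hmK' : (m : ℝ) ≤ K := Nat.cast_le.2 hmK
  rw [longLength, coe_breakpoint_of_lt hL hK hm h, ← le_div_iff₀' hL]
  rcases k with _ | k
  · simp only [rawBreak, mul_zero, zero_add, if_true] at hle ⊢
    rw [sub_zero]
    exact hle.trans (div_le_div_of_nonneg_right hmK' hL.le)
  · rw [rawBreak_odd] at hle
    rw [show 2 * (k + 1) = 2 * k + 2 by ring] at hle ⊢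
    rw [rawBreak_even]
    refine (sub_le_sub_right hle _).trans (le_of_eq ?_)
    push_cast
    ring

theorem sum_longLength_le (hL : 0 < L) (hK : 0 < K) (hm : 0 < m) (N : ℕ) :
    ∑ k ∈ Finset.range N, longLength L K m k ≤ L := by
  have h1 : ∀ k ∈ Finset.range N, longLength L K m k ≤
      L * ((breakpoint L K m (2 * (k + 1)) : ℝ) - breakpoint L K m (2 * k)) := fun k _ =>
    mul_le_mul_of_nonneg_left (sub_le_sub_right
      (Subtype.coe_le_coe.2 (monotone_breakpoint hL hK hm (by omega))) _) hL.le
  refine (Finset.sum_le_sum h1).trans ?_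
  rw [← Finset.mul_sum, Finset.sum_range_sub fun k => (breakpoint L K m (2 * k) : ℝ)]
  have h2 := (breakpoint L K m (2 * N)).2.2
  have h3 := (breakpoint L K m (2 * 0)).2.1
  nlinarith

/-- The labelled points that lie over the `k`-th long interval. -/
def longCell (L : ℝ) (K m k : ℕ) : Set (unitInterval × unitInterval) :=
  {z | z.1 ∈ cell (breakpoint L K m) (2 * k)}

/-- The labelled points that do not lie over a long interval. -/
def shortRegion (L : ℝ) (K m : ℕ) : Set (unitInterval × unitInterval) :=
  {z | ∀ k, z ∉ longCell L K m k}

theorem measurableSet_longCell (L : ℝ) (K m k : ℕ) : MeasurableSet (longCell L K m k) := by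
  unfold longCell cell
  by_cases h : breakpoint L K m (2 * k) < 1
  · simp only [h, true_and]
    exact measurable_fst (measurableSet_Icc (a := breakpoint L K m (2 * k))
      (b := breakpoint L K m (2 * k + 1)))
  · simp [h]

theorem measurableSet_shortRegion (L : ℝ) (K m : ℕ) : MeasurableSet (shortRegion L K m) := by
  have : shortRegion L K m = ⋂ k, (longCell L K m k)ᶜ := by
    ext z; simp [shortRegion]
  rw [this]
  exact MeasurableSet.iInter fun k => (measurableSet_longCell L K m k).compl

/-- Before clipping, the breakpoints other than `0` are `1 / L` times integers, and a short interval
has unit length in that scale. Its left end belongs to the preceding long interval, so the point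
lies strictly to the right of it and the ceiling is determined. -/
theorem ceil_of_mem_shortRegion (hL : 0 < L) (hK : 0 < K) (hm : 0 < m)
    {z : unitInterval × unitInterval} (hz : z ∈ shortRegion L K m) :
    ∃ k : ℕ, ⌈L * (z.1 : ℝ)⌉₊ = m + k * (K + 1) + 1 := by
  obtain ⟨i, hi⟩ := exists_mem_cell (L := L) (K := K) (m := m) hL hK hm z.1
  rcases Nat.even_or_odd i with ⟨k, rfl⟩ | ⟨k, rfl⟩
  · refine absurd ?_ (hz k)
    rw [← two_mul] at hi
    exact hi
  · refine ⟨k, ?_⟩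
    have hne : breakpoint L K m (2 * k + 1) < z.1 := by
      refine lt_of_le_of_ne hi.2.1 fun heq => hz k ⟨?_, ?_, ?_⟩
      · exact (monotone_breakpoint hL hK hm (Nat.le_succ _)).trans_lt hi.1
      · exact heq ▸ monotone_breakpoint hL hK hm (Nat.le_succ _)
      · exact heq ▸ le_rfl
    have h1 : ((m : ℝ) + k * (K + 1)) / L < z.1 := by
      rw [← rawBreak_odd, ← coe_breakpoint_of_lt hL hK hm hi.1]
      exact hne
    have h2 : (z.1 : ℝ) ≤ ((m : ℝ) + k * (K + 1) + 1) / L := by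
      rw [← rawBreak_even]
      exact (Subtype.coe_le_coe.2 hi.2.2).trans (coe_breakpoint_le hL hK hm _)
    rw [div_lt_iff₀ hL] at h1
    rw [le_div_iff₀ hL] at h2
    rw [Nat.ceil_eq_iff (by omega)]
    rw [Nat.add_sub_cancel]
    push_cast
    constructor <;> linarith

/-- The average over the offsets of the mass outside the long intervals. -/
theorem sum_measureReal_shortRegion_le (D : Measure (unitInterval × unitInterval))
    [IsProbabilityMeasure D] (hL : 0 < L) (K : ℕ) :
    ∑ r : Fin K, D.real (shortRegion L K (r + 1)) ≤ 1 := by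
  rw [← measureReal_biUnion_finset]
  · exact measureReal_le_one
  · intro r _ r' _ hne
    refine Set.disjoint_left.2 fun z hz hz' => hne ?_
    have hK : 0 < K := r.pos
    obtain ⟨k, hk⟩ := ceil_of_mem_shortRegion hL hK (Nat.succ_pos r) hz
    obtain ⟨k', hk'⟩ := ceil_of_mem_shortRegion hL hK (Nat.succ_pos r') hz'
    -- The offsets `1, ..., K` are distinct residues modulo the period `K + 1`.
    have h : (r + 1 + k * (K + 1) : ℕ) = r' + 1 + k' * (K + 1) := by omega
    have h1 := congrArg (· % (K + 1)) h
    simp only [Nat.add_mul_mod_self_right] at h1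
    rw [Nat.mod_eq_of_lt (by omega), Nat.mod_eq_of_lt (by omega)] at h1
    exact Fin.ext (by omega)
  · exact fun r _ => measurableSet_shortRegion L K _

/-! ### Grids on the long intervals -/

/-- The grid square of a point, for a grid of mesh `1 / J ^ 2` in the label and
`1 / (J ^ 2 L)` to the right of `u` in the argument. -/
def gridIndex (L : ℝ) (J : ℕ) (u : ℝ) (z : unitInterval × unitInterval) : ℕ × ℕ :=
  (⌊(J : ℝ) ^ 2 * (L * ((z.1 : ℝ) - u))⌋₊, ⌊(J : ℝ) ^ 2 * (z.2 : ℝ)⌋₊)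

theorem measurable_gridIndex (L : ℝ) (J : ℕ) (u : ℝ) : Measurable (gridIndex L J u) := by
  refine Measurable.prodMk (Nat.measurable_floor.comp ?_) (Nat.measurable_floor.comp ?_)
  · exact (((measurable_subtype_coe.comp measurable_fst).sub_const u).const_mul L).const_mul _
  · exact (measurable_subtype_coe.comp measurable_snd).const_mul _

theorem abs_sub_le_one_of_floor_eq {s t : ℝ} (hs : 0 ≤ s) (ht : 0 ≤ t) (h : ⌊s⌋₊ = ⌊t⌋₊) :
    |s - t| ≤ 1 := by
  have h1 := Nat.floor_le hs
  have h2 := Nat.floor_le ht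
  have h3 := Nat.lt_floor_add_one s
  have h4 := Nat.lt_floor_add_one t
  rw [h] at h1 h3
  rw [abs_le]; constructor <;> linarith

theorem abs_sub_le_of_floor_div_eq {J : ℕ} (hJ : 0 < J) {s t : ℝ} (hs : 0 ≤ s) (ht : 0 ≤ t)
    (h : ⌊(J : ℝ) ^ 2 * s⌋₊ / J = ⌊(J : ℝ) ^ 2 * t⌋₊ / J) : |s - t| ≤ 1 / J := by
  have hJ' : (0 : ℝ) < J := Nat.cast_pos.2 hJ
  -- Integer division of the fine index by `J` is the floor on the mesh `1 / J`, so the coarse grid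
  -- is a coarsening of the fine one.
  rw [← Nat.floor_div_natCast, ← Nat.floor_div_natCast] at h
  have h1 := abs_sub_le_one_of_floor_eq (by positivity) (by positivity) h
  have h2 : (J : ℝ) ^ 2 * s / J - (J : ℝ) ^ 2 * t / J = J * (s - t) := by field_simp
  rw [h2, abs_mul, abs_of_pos hJ'] at h1
  rwa [le_div_iff₀' hJ']

theorem abs_sub_le_of_floor_eq {J : ℕ} (hJ : 0 < J) {s t : ℝ} (hs : 0 ≤ s) (ht : 0 ≤ t)
    (h : ⌊(J : ℝ) ^ 2 * s⌋₊ = ⌊(J : ℝ) ^ 2 * t⌋₊) : |s - t| ≤ 1 / (J : ℝ) ^ 2 := by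
  have hJ' : (0 : ℝ) < J := Nat.cast_pos.2 hJ
  have h1 := abs_sub_le_one_of_floor_eq (by positivity) (by positivity) h
  rw [← mul_sub, abs_mul, abs_of_pos (by positivity : (0 : ℝ) < (J : ℝ) ^ 2)] at h1
  rwa [le_div_iff₀' (by positivity)]

/-! ### Loss differences and the number of grid squares -/

/-- The difference of the losses of two predictors. -/
def lossDiff (f g : unitInterval → unitInterval) (z : unitInterval × unitInterval) : ℝ :=
  |(z.2 : ℝ) - f z.1| - |(z.2 : ℝ) - g z.1|

theorem abs_lossDiff_le_one (f g : unitInterval → unitInterval)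
    (z : unitInterval × unitInterval) : |lossDiff f g z| ≤ 1 := by
  have h1 : ∀ a b : unitInterval, |(a : ℝ) - b| ≤ 1 := fun a b => by
    have := a.2.1; have := a.2.2; have := b.2.1; have := b.2.2
    rw [abs_le]; constructor <;> linarith
  have h2 := h1 z.2 (f z.1)
  have h3 := h1 z.2 (g z.1)
  have h4 := abs_nonneg ((z.2 : ℝ) - f z.1)
  have h5 := abs_nonneg ((z.2 : ℝ) - g z.1)
  rw [lossDiff, abs_le]; constructor <;> linarith

theorem abs_lossDiff_sub_le {f g : unitInterval → unitInterval} (hf : f ∈ lipClass L)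
    (hg : g ∈ lipClass L) (z z' : unitInterval × unitInterval) :
    |lossDiff f g z - lossDiff f g z'| ≤
      2 * |(z.2 : ℝ) - z'.2| + 2 * (L * |(z.1 : ℝ) - z'.1|) := by
  have h1 : ∀ f : unitInterval → unitInterval, f ∈ lipClass L →
      |(|(z.2 : ℝ) - f z.1| - |(z'.2 : ℝ) - f z'.1|)| ≤
        |(z.2 : ℝ) - z'.2| + L * |(z.1 : ℝ) - z'.1| := fun f hf => by
    refine (abs_abs_sub_abs_le_abs_sub _ _).trans ?_
    have h : (z.2 : ℝ) - f z.1 - ((z'.2 : ℝ) - f z'.1) =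
      ((z.2 : ℝ) - z'.2) - ((f z.1 : ℝ) - f z'.1) := by ring
    rw [h]
    exact (abs_sub _ _).trans (add_le_add le_rfl (hf _ _))
  have h : lossDiff f g z - lossDiff f g z' = (|(z.2 : ℝ) - f z.1| - |(z'.2 : ℝ) - f z'.1|) -
      (|(z.2 : ℝ) - g z.1| - |(z'.2 : ℝ) - g z'.1|) := by unfold lossDiff; ring
  rw [h]
  refine (abs_sub _ _).trans ?_
  linarith [h1 f hf, h1 g hg]

theorem continuous_of_mem_lipClass (hL : 0 < L) {f : unitInterval → unitInterval}
    (hf : f ∈ lipClass L) : Continuous f := by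
  have : LipschitzWith ⟨L, hL.le⟩ f := LipschitzWith.of_dist_le_mul fun x y => hf x y
  exact this.continuous

theorem continuous_lossDiff (hL : 0 < L) {f g : unitInterval → unitInterval}
    (hf : f ∈ lipClass L) (hg : g ∈ lipClass L) : Continuous (lossDiff f g) := by
  have h1 := continuous_of_mem_lipClass hL hf
  have h2 := continuous_of_mem_lipClass hL hg
  unfold lossDiff
  fun_prop

theorem integrable_lossDiff (D : Measure (unitInterval × unitInterval)) [IsProbabilityMeasure D]
    (hL : 0 < L) {f g : unitInterval → unitInterval}
    (hf : f ∈ lipClass L) (hg : g ∈ lipClass L) : Integrable (lossDiff f g) D :=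
  integrable_of_abs_le (continuous_lossDiff hL hf hg).measurable (abs_lossDiff_le_one f g)

/-- The fine grid squares over the `k`-th long interval. -/
def fineSquares (L : ℝ) (K J m k : ℕ) : Finset (ℕ × ℕ) :=
  Finset.range (⌊(J : ℝ) ^ 2 * longLength L K m k⌋₊ + 1) ×ˢ Finset.range (J ^ 2 + 1)

/-- The coarse grid squares over the `k`-th long interval. -/
def coarseSquares (L : ℝ) (K J m k : ℕ) : Finset (ℕ × ℕ) :=
  Finset.range (⌊(J : ℝ) ^ 2 * longLength L K m k⌋₊ / J + 1) ×ˢ Finset.range (J ^ 2 / J + 1)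

theorem gridIndex_mem (hL : 0 < L) {J k : ℕ} {z : unitInterval × unitInterval}
    (hz : z ∈ longCell L K m k) :
    (gridIndex L J (breakpoint L K m (2 * k)) z).1 ≤ ⌊(J : ℝ) ^ 2 * longLength L K m k⌋₊ ∧
      (gridIndex L J (breakpoint L K m (2 * k)) z).2 ≤ J ^ 2 := by
  constructor
  · refine Nat.floor_le_floor (mul_le_mul_of_nonneg_left ?_ (by positivity))
    exact mul_le_mul_of_nonneg_left (sub_le_sub_right (Subtype.coe_le_coe.2 hz.2.2) _) hL.le
  · refine Nat.floor_le_of_le ?_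
    push_cast
    exact mul_le_of_le_one_right (by positivity) z.2.2.2

/-- There are about `J ^ 4 * ℓ` fine and `J ^ 2 * ℓ` coarse squares, for `ℓ` the length in units of
`1 / L`. With `J ^ 2 ≤ 4 * K` both terms are of order `K ^ 2 * ℓ`; the `+ 1` allows for incomplete
squares. -/
theorem card_squares_le (hL : 0 < L) (hK : 0 < K) (hm : 0 < m) {J : ℕ} (hJ : 0 < J)
    (hKJ : J ^ 2 ≤ 4 * K) (k : ℕ) :
    2 * (K : ℝ) * (fineSquares L K J m k).card / (J : ℝ) ^ 2 +
        K * (coarseSquares L K J m k).card / 2 + 1 / 2 ≤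
      24 * (K : ℝ) ^ 2 * (longLength L K m k + 1) := by
  have hℓ := longLength_nonneg (L := L) (K := K) (m := m) hL hK hm k
  set ℓ := longLength L K m k with hℓ'
  have hJ1 : (1 : ℝ) ≤ J := Nat.one_le_cast.2 hJ
  have hK1 : (1 : ℝ) ≤ K := Nat.one_le_cast.2 hK
  have hJK : (J : ℝ) ^ 2 ≤ 4 * K := by exact_mod_cast hKJ
  have hfl : (⌊(J : ℝ) ^ 2 * ℓ⌋₊ : ℝ) ≤ (J : ℝ) ^ 2 * ℓ := Nat.floor_le (by positivity)
  have c1 : ((fineSquares L K J m k).card : ℝ) ≤ ((J : ℝ) ^ 2 * ℓ + 1) * (2 * (J : ℝ) ^ 2) := by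
    simp only [fineSquares, Finset.card_product, Finset.card_range, ← hℓ']
    push_cast
    have : (1 : ℝ) ≤ (J : ℝ) ^ 2 := one_le_pow₀ hJ1
    exact mul_le_mul (by linarith) (by linarith) (by positivity) (by positivity)
  have c2 : ((coarseSquares L K J m k).card : ℝ) ≤ (J * ℓ + 1) * (2 * J) := by
    simp only [coarseSquares, Finset.card_product, Finset.card_range, ← hℓ']
    have h1 : ((⌊(J : ℝ) ^ 2 * ℓ⌋₊ / J : ℕ) : ℝ) ≤ J * ℓ := by
      refine Nat.cast_div_le.trans ?_
      rw [div_le_iff₀ (by linarith)]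
      linarith
    have h2 : J ^ 2 / J = J := by rw [sq]; exact Nat.mul_div_cancel J hJ
    rw [h2]
    push_cast
    exact mul_le_mul (by linarith) (by linarith) (by positivity) (by positivity)
  have d1 : 2 * (K : ℝ) * (fineSquares L K J m k).card / (J : ℝ) ^ 2 ≤
      4 * K * ((J : ℝ) ^ 2 * ℓ + 1) := by
    rw [div_le_iff₀ (by positivity)]
    nlinarith
  have d2 : (K : ℝ) * (coarseSquares L K J m k).card / 2 ≤ K * ((J : ℝ) ^ 2 * ℓ + J) := by
    nlinarith
  have d3 : (J : ℝ) ≤ (J : ℝ) ^ 2 := by nlinarith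
  have d4 : (J : ℝ) ^ 2 * ℓ ≤ 4 * K * ℓ := mul_le_mul_of_nonneg_right hJK hℓ
  have d5 : (K : ℝ) * (5 * ((J : ℝ) ^ 2 * ℓ) + J + 4) ≤ K * (20 * (K * ℓ) + 8 * K) :=
    mul_le_mul_of_nonneg_left (by linarith) (by linarith)
  have d6 : (1 : ℝ) ≤ K * K := by nlinarith
  have d7 : 0 ≤ (K : ℝ) * K * ℓ := by positivity
  nlinarith

end Partition

/-! ### Label queries -/

namespace LabelComp

variable {ι α β : Type}

theorem output_bind (y : ι → unitInterval) (c : LabelComp ι α) (g : α → LabelComp ι β) :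
    (c.bind g).output y = (g (c.output y)).output y := by
  induction c with
  | ret a => rfl
  | ask i k ih => exact ih (y i)

theorem queries_bind (y : ι → unitInterval) (c : LabelComp ι α) (g : α → LabelComp ι β) :
    (c.bind g).queries y = c.queries y ++ (g (c.output y)).queries y := by
  induction c with
  | ret a => rfl
  | ask i k ih => exact congrArg (i :: ·) (ih (y i))

theorem output_collect (y pts : ι → unitInterval) (l : List ι) :
    (collect pts l).output y = l.map fun i => (pts i, y i) := by
  induction l with
  | nil => rfl
  | cons i l ih => simp [collect, output, output_bind, ih]

theorem queries_collect (y pts : ι → unitInterval) (l : List ι) :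
    (collect pts l).queries y = l := by
  induction l with
  | nil => rfl
  | cons i l ih => simp [collect, queries, queries_bind, ih]

end LabelComp

/-! ### The answers to queries -/

section Query

variable {L : ℝ} {K m M : ℕ}
  {erm : List (unitInterval × unitInterval) → unitInterval → unitInterval}

/-- The labelled kept samples in the `i`-th interval. -/
def labelledIn (P : Prepared M) (y : Fin M → unitInterval) (i : ℕ) :
    List (unitInterval × unitInterval) :=
  (samplesIn P i).map fun j => (P.pts j, y j)

/-- The value that a query in the `i`-th interval, a short one, uses at its right end point. -/
def upperValue (erm : List (unitInterval × unitInterval) → unitInterval → unitInterval)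
    (P : Prepared M) (y : Fin M → unitInterval) (i : ℕ) : ℝ :=
  if P.b (i + 1) < 1 then erm (labelledIn P y (i + 1)) (P.b (i + 1))
  else erm (labelledIn P y (i - 1)) (P.b i)

theorem query_long (hL : 0 < L) (hK : 0 < K) (hm : 0 < m) {P : Prepared M}
    (hP : P.b = breakpoint L K m) (y : Fin M → unitInterval) {i : ℕ} (hi : Even i)
    {x : unitInterval} (hx : x ∈ cell P.b i) :
    (query erm P x).output y = erm (labelledIn P y i) x ∧
      (query erm P x).queries y = samplesIn P i := by
  classical
  have hl : ∃ i, Even i ∧ x ∈ cell P.b i := ⟨i, hi, hx⟩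
  have huniq : ∀ i', Even i' ∧ x ∈ cell P.b i' → i' = i := fun i' ⟨h, hx'⟩ => by
    rw [hP] at hx hx'
    exact cell_index_unique hL hK hm (iff_of_true h hi) hx' hx
  have hfind : ∀ inst, @Nat.find (fun i => Even i ∧ x ∈ cell P.b i) inst hl = i := fun inst =>
    huniq _ (@Nat.find_spec (fun i => Even i ∧ x ∈ cell P.b i) inst hl)
  rw [query, dif_pos hl]
  simp only [LabelComp.output_bind, LabelComp.queries_bind, LabelComp.output_collect,
    LabelComp.queries_collect, hfind, LabelComp.output, LabelComp.queries, List.append_nil]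
  exact ⟨rfl, trivial⟩

theorem query_short (hL : 0 < L) (hK : 0 < K) (hm : 0 < m) {P : Prepared M}
    (hP : P.b = breakpoint L K m) (y : Fin M → unitInterval) {i : ℕ} (hi : Odd i)
    {x : unitInterval} (hx : x ∈ cell P.b i) (hnl : ¬ ∃ i, Even i ∧ x ∈ cell P.b i) :
    (query erm P x).output y = erm (labelledIn P y (i - 1)) (P.b i) + ((x : ℝ) - P.b i) *
        ((upperValue erm P y i - erm (labelledIn P y (i - 1)) (P.b i)) /
          ((P.b (i + 1) : ℝ) - P.b i)) ∧
      (query erm P x).queries y = samplesIn P (i - 1) ++ samplesIn P (i + 1) := by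
  classical
  have hl : ∃ i, Odd i ∧ x ∈ cell P.b i := ⟨i, hi, hx⟩
  have huniq : ∀ i', Odd i' ∧ x ∈ cell P.b i' → i' = i := fun i' ⟨h, hx'⟩ => by
    rw [hP] at hx hx'
    exact cell_index_unique hL hK hm (iff_of_false (Nat.not_even_iff_odd.2 h) (Nat.not_even_iff_odd.2 hi)) hx' hx
  have hfind : ∀ inst, @Nat.find (fun i => Odd i ∧ x ∈ cell P.b i) inst hl = i := fun inst =>
    huniq _ (@Nat.find_spec (fun i => Odd i ∧ x ∈ cell P.b i) inst hl)
  have hpos : 0 < P.b i := by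
    rw [hP]; exact breakpoint_one_pos hL hK hm hi.pos
  rw [query, dif_neg hnl, dif_pos hl]
  simp only [LabelComp.output_bind, LabelComp.queries_bind, LabelComp.output_collect,
    LabelComp.queries_collect, hfind, LabelComp.output, LabelComp.queries, List.append_nil, hpos,
    if_true]
  exact ⟨rfl, trivial⟩

/-- On a short interval, end points included, the answers interpolate linearly. -/
theorem output_query_of_odd (hL : 0 < L) (hK : 0 < K) (hm : 0 < m) {P : Prepared M}
    (hP : P.b = breakpoint L K m) (y : Fin M → unitInterval) {i : ℕ} (hi : Odd i)
    {x : unitInterval} (hx : x ∈ cell P.b i) :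
    (query erm P x).output y = erm (labelledIn P y (i - 1)) (P.b i) + ((x : ℝ) - P.b i) *
      ((upperValue erm P y i - erm (labelledIn P y (i - 1)) (P.b i)) /
        ((P.b (i + 1) : ℝ) - P.b i)) := by
  -- A point of a short interval that also lies in a long one is a common end point. The query then
  -- takes the long branch, and its answer equals the interpolated value there.
  by_cases hnl : ∃ i, Even i ∧ x ∈ cell P.b i
  · obtain ⟨i', hi', hx'⟩ := hnl
    have hmono : Monotone P.b := hP ▸ monotone_breakpoint hL hK hm
    have hlt : P.b i < P.b (i + 1) := by
      have h := hx.1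
      rw [hP] at h ⊢
      exact breakpoint_lt_succ hL hK hm h
    have hne : i' ≠ i := fun h => Nat.not_even_iff_odd.2 hi (h ▸ hi')
    rcases lt_or_gt_of_ne hne with h | h
    · have hxe : x = P.b i := le_antisymm (hx'.2.2.trans (hmono h)) hx.2.1
      have hi1 : i' = i - 1 := by
        have hmem : x ∈ cell P.b (i - 1) := by
          refine ⟨(hmono (Nat.sub_le i 1)).trans_lt hx.1, ?_, ?_⟩
          · rw [hxe]; exact hmono (Nat.sub_le i 1)
          · rw [hxe, Nat.sub_add_cancel hi.pos]
        rw [hP] at hx' hmem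
        exact cell_index_unique hL hK hm
          (iff_of_true hi' (Nat.Odd.sub_odd hi odd_one)) hx' hmem
      rw [(query_long hL hK hm hP y hi' hx').1, hi1, hxe]
      simp
    · have hxe : x = P.b (i + 1) := le_antisymm hx.2.2 ((hmono h).trans hx'.2.1)
      have hb1 : P.b (i + 1) < 1 := (hmono h).trans_lt hx'.1
      have hi1 : i' = i + 1 := by
        have hmem : x ∈ cell P.b (i + 1) := by
          refine ⟨hb1, hxe.ge, ?_⟩
          rw [hxe]; exact hmono (Nat.le_succ _)
        rw [hP] at hx' hmem
        exact cell_index_unique hL hK hm (iff_of_true hi' hi.add_one) hx' hmem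
      have hsub : (P.b (i + 1) : ℝ) - P.b i ≠ 0 := (sub_pos.2 (Subtype.coe_lt_coe.2 hlt)).ne'
      rw [(query_long hL hK hm hP y hi' hx').1, hi1, hxe, mul_div_cancel₀ _ hsub, upperValue,
        if_pos hb1]
      ring
  · exact (query_short hL hK hm hP y hi hx hnl).1

theorem upperValue_mem (P : Prepared M) (y : Fin M → unitInterval) (i : ℕ) :
    upperValue erm P y i ∈ Set.Icc (0 : ℝ) 1 := by
  unfold upperValue
  split_ifs <;> exact Subtype.property _

theorem output_query_mem (hL : 0 < L) (hK : 0 < K) (hm : 0 < m) {P : Prepared M}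
    (hP : P.b = breakpoint L K m) (y : Fin M → unitInterval) (x : unitInterval) :
    (query erm P x).output y ∈ Set.Icc (0 : ℝ) 1 := by
  obtain ⟨i, hi⟩ := exists_mem_cell (L := L) (K := K) (m := m) hL hK hm x
  rw [← hP] at hi
  rcases Nat.even_or_odd i with h | h
  · rw [(query_long hL hK hm hP y h hi).1]
    exact Subtype.property _
  · rw [output_query_of_odd hL hK hm hP y h hi]
    have hlt : P.b i < P.b (i + 1) := by
      have h := hi.1
      rw [hP] at h ⊢
      exact breakpoint_lt_succ hL hK hm h
    have hsub : 0 < (P.b (i + 1) : ℝ) - P.b i := sub_pos.2 (Subtype.coe_lt_coe.2 hlt)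
    have hu := upperValue_mem (erm := erm) P y i
    have hl : (erm (labelledIn P y (i - 1)) (P.b i) : ℝ) ∈ Set.Icc (0 : ℝ) 1 := Subtype.property _
    set u := upperValue erm P y i
    set v : ℝ := (erm (labelledIn P y (i - 1)) (P.b i) : ℝ)
    set s := ((x : ℝ) - P.b i) / ((P.b (i + 1) : ℝ) - P.b i) with hs
    have hs0 : 0 ≤ s := div_nonneg (sub_nonneg.2 (Subtype.coe_le_coe.2 hi.2.1)) hsub.le
    have hs1 : s ≤ 1 := (div_le_one hsub).2 (sub_le_sub_right (Subtype.coe_le_coe.2 hi.2.2) _)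
    have heq : v + ((x : ℝ) - P.b i) * ((u - v) / ((P.b (i + 1) : ℝ) - P.b i)) =
        (1 - s) * v + s * u := by
      rw [hs]; field_simp; ring
    rw [heq]
    exact convex_Icc (0 : ℝ) 1 hl hu (sub_nonneg.2 hs1) hs0 (by ring)

/-- A function that is Lipschitz on each interval of a partition is Lipschitz. -/
theorem lipschitz_of_cells {F : unitInterval → ℝ} {b : ℕ → unitInterval} (hb0 : b 0 = 0)
    (hb1 : ∃ n, b n = 1)
    (h : ∀ n, ∀ x ∈ cell b n, ∀ y ∈ cell b n, |F x - F y| ≤ L * |(x : ℝ) - y|)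
    (x y : unitInterval) : |F x - F y| ≤ L * |(x : ℝ) - y| := by
  -- Induction on the number of cells: when `b n` separates `x` from `y`, the two estimates add up
  -- because the distances do.
  have key : ∀ n, ∀ x y : unitInterval, x ≤ y → y ≤ b n → |F x - F y| ≤ L * |(x : ℝ) - y| := by
    intro n
    induction n with
    | zero =>
      intro x y hxy hy
      rw [hb0] at hy
      have hy0 : y = 0 := le_antisymm hy unitInterval.nonneg'
      have hx0 : x = 0 := le_antisymm (hxy.trans hy) unitInterval.nonneg'
      simp [hx0, hy0]
    | succ n ih =>
      intro x y hxy hy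
      rcases le_total y (b n) with h1 | h1
      · exact ih x y hxy h1
      rcases (unitInterval.le_one' (t := b n)).lt_or_eq with hlt | heq
      · rcases le_total (b n) x with h2 | h2
        · exact h n x ⟨hlt, h2, hxy.trans hy⟩ y ⟨hlt, h1, hy⟩
        · have e1 := ih x (b n) h2 le_rfl
          have e2 := h n (b n) ⟨hlt, le_rfl, h1.trans hy⟩ y ⟨hlt, h1, hy⟩
          have h2' : (x : ℝ) ≤ b n := h2
          have h1' : (b n : ℝ) ≤ y := h1
          rw [abs_of_nonpos (sub_nonpos.2 h2')] at e1
          rw [abs_of_nonpos (sub_nonpos.2 h1')] at e2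
          rw [abs_of_nonpos (sub_nonpos.2 (h2'.trans h1'))]
          have := abs_sub_le (F x) (F (b n)) (F y)
          linarith
      · exact ih x y hxy (heq ▸ unitInterval.le_one')
  obtain ⟨n, hn⟩ := hb1
  rcases le_total x y with hxy | hxy
  · exact key n x y hxy (hn ▸ unitInterval.le_one')
  · rw [abs_sub_comm, abs_sub_comm (x : ℝ)]
    exact key n y x hxy (hn ▸ unitInterval.le_one')

/-- On a short interval that ends before `1`, the rise is at most `1` over a length of `1 / L`. If
the interval reaches `1` it may be shorter, but there both interpolation values agree and the slope
is zero. -/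
theorem lipschitz_output_query (hL : 0 < L) (hK : 0 < K) (hm : 0 < m) {P : Prepared M}
    (hP : P.b = breakpoint L K m) (herm : ∀ data, IsERM L data (erm data))
    (y : Fin M → unitInterval) (x x' : unitInterval) :
    |(query erm P x).output y - (query erm P x').output y| ≤ L * |(x : ℝ) - x'| := by
  refine lipschitz_of_cells (F := fun x => (query erm P x).output y) (b := P.b)
    (hP ▸ breakpoint_zero) (hP ▸ exists_breakpoint_eq_one hL hK hm) (fun i x hx x' hx' => ?_) x x'
  rcases Nat.even_or_odd i with h | h
  · rw [(query_long hL hK hm hP y h hx).1, (query_long hL hK hm hP y h hx').1]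
    exact (herm _).1 x x'
  · rw [output_query_of_odd hL hK hm hP y h hx, output_query_of_odd hL hK hm hP y h hx']
    have hslope : |(upperValue erm P y i - erm (labelledIn P y (i - 1)) (P.b i)) /
        ((P.b (i + 1) : ℝ) - P.b i)| ≤ L := by
      by_cases hb : P.b (i + 1) < 1
      · have hlen : (P.b (i + 1) : ℝ) - P.b i = 1 / L := by
          rw [hP] at hb ⊢
          exact short_length hL hK hm h hb
        have hu := upperValue_mem (erm := erm) P y i
        have hl := (erm (labelledIn P y (i - 1)) (P.b i)).2
        rw [hlen, div_div_eq_mul_div, div_one, abs_mul, abs_of_pos hL]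
        refine mul_le_of_le_one_left hL.le ?_
        rw [abs_le]; constructor <;> linarith [hu.1, hu.2, hl.1, hl.2]
      · rw [upperValue, if_neg hb]
        simpa using hL.le
    rw [add_sub_add_left_eq_sub, ← sub_mul, sub_sub_sub_cancel_right, abs_mul, mul_comm]
    exact mul_le_mul_of_nonneg_right hslope (abs_nonneg _)

/-! ### The kept samples in a long interval -/

/-- The cap on the number of earlier samples in a long interval. -/
def sampleCap (K : ℕ) : ℝ := 1 / 2 * (K : ℝ) ^ 4 * Real.log K

/-- The discarding rule ranges over all long intervals, but a sample lies in at most one, so a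
single count decides. -/
theorem mem_kept_iff (hL : 0 < L) {r : Fin K} {z : Fin M → unitInterval × unitInterval} {j : Fin M}
    {k : ℕ} (hj : z j ∈ longCell L K (r + 1) k) :
    j ∈ (preprocess L K r fun j => (z j).1).kept ↔
      priorCount (longCell L K (r + 1) k) z j ≤ sampleCap K := by
  classical
  have hcount : ∀ k, (((Finset.univ.filter fun j' : Fin M =>
      j' < j ∧ (z j').1 ∈ cell (breakpoint L K (r + 1)) (2 * k)).card : ℕ) : ℝ) =
      priorCount (longCell L K (r + 1) k) z j := by
    intro k
    rw [priorCount, ← Finset.filter_filter, Finset.card_filter]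
    push_cast
    refine Finset.sum_congr rfl fun j' _ => ?_
    simp [Set.indicator_apply, longCell]
  simp only [preprocess, Finset.mem_filter, Finset.mem_univ, true_and]
  constructor
  · intro h
    have := h (2 * k) (even_two_mul k) hj
    rw [← hcount, sampleCap]
    convert this
  · intro h i hi hji
    have hik := cell_index_unique hL r.pos (Nat.succ_pos r)
      (iff_of_true hi (even_two_mul k)) hji hj
    subst hik
    rw [← hcount, sampleCap] at h
    convert h

/-- The link between the lists handled by the algorithm and the predictable sums of the
probabilistic part. -/
theorem sum_samplesIn (hL : 0 < L) (r : Fin K) (z : Fin M → unitInterval × unitInterval) (k : ℕ)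
    (f : unitInterval × unitInterval → ℝ) :
    ((samplesIn (preprocess L K r fun j => (z j).1) (2 * k)).map fun j => f (z j)).sum =
      ∑ j, active (longCell L K (r + 1) k) (sampleCap K) j z *
        (longCell L K (r + 1) k).indicator f (z j) := by
  classical
  have hnd : (samplesIn (preprocess L K r fun j => (z j).1) (2 * k)).Nodup :=
    (List.nodup_finRange M).filter _
  rw [← List.sum_toFinset _ hnd]
  have hset : (samplesIn (preprocess L K r fun j => (z j).1) (2 * k)).toFinset =
      Finset.univ.filter fun j => priorCount (longCell L K (r + 1) k) z j ≤ sampleCap K ∧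
        z j ∈ longCell L K (r + 1) k := by
    ext j
    simp only [samplesIn, List.mem_toFinset, List.mem_filter, List.mem_finRange, true_and,
      decide_eq_true_eq, Finset.mem_filter, Finset.mem_univ]
    refine and_congr_left_iff.2 fun hj => ?_
    exact mem_kept_iff hL hj
  rw [hset, Finset.sum_filter]
  refine Finset.sum_congr rfl fun j _ => ?_
  by_cases h1 : priorCount (longCell L K (r + 1) k) z j ≤ sampleCap K <;>
    by_cases h2 : z j ∈ longCell L K (r + 1) k <;> simp [active, h1, h2]

theorem sampleCap_nonneg (K : ℕ) : 0 ≤ sampleCap K := by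
  have : 0 ≤ Real.log K := Real.log_natCast_nonneg K
  unfold sampleCap
  positivity

theorem length_samplesIn_le (hL : 0 < L) (r : Fin K) (z : Fin M → unitInterval × unitInterval)
    {i : ℕ} (hi : Even i) :
    ((samplesIn (preprocess L K r fun j => (z j).1) i).length : ℝ) ≤ sampleCap K + 1 := by
  obtain ⟨k, rfl⟩ := hi
  rw [← two_mul]
  have h := sum_samplesIn hL r z k fun _ => 1
  simp only [List.map_const', List.sum_replicate, nsmul_eq_mul, mul_one] at h
  rw [h]
  exact keptHits_le_cap _ (sampleCap_nonneg K) z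

theorem mem_kept_of_mem_samplesIn {P : Prepared M} {i : ℕ} {j : Fin M} (h : j ∈ samplesIn P i) :
    j ∈ P.kept := by
  classical
  simp only [samplesIn, List.mem_filter, decide_eq_true_eq] at h
  exact h.2.1

theorem queries_query (hL : 0 < L) (r : Fin K) (z : Fin M → unitInterval × unitInterval)
    (x : unitInterval) :
    (∀ j ∈ (query erm (preprocess L K r fun j => (z j).1) x).queries fun j => (z j).2,
        j ∈ (preprocess L K r fun j => (z j).1).kept) ∧
      (((query erm (preprocess L K r fun j => (z j).1) x).queries fun j => (z j).2).length : ℝ) ≤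
        2 * (sampleCap K + 1) := by
  have hcap := sampleCap_nonneg K
  have hP : (preprocess L K r fun j => (z j).1).b = breakpoint L K (r + 1) := rfl
  by_cases hl : ∃ i, Even i ∧ x ∈ cell (preprocess L K r fun j => (z j).1).b i
  · obtain ⟨i, hi, hx⟩ := hl
    rw [(query_long hL r.pos (Nat.succ_pos r) hP _ hi hx).2]
    refine ⟨fun j hj => mem_kept_of_mem_samplesIn hj, ?_⟩
    linarith [length_samplesIn_le hL r z hi]
  · obtain ⟨i, hx⟩ := exists_mem_cell hL r.pos (Nat.succ_pos (r : ℕ)) x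
    have hi : Odd i := by
      rw [← Nat.not_even_iff_odd]
      exact fun h => hl ⟨i, h, hx⟩
    rw [(query_short hL r.pos (Nat.succ_pos r) hP _ hi hx hl).2]
    constructor
    · intro j hj
      rcases List.mem_append.1 hj with h | h <;> exact mem_kept_of_mem_samplesIn h
    · rw [List.length_append, Nat.cast_add]
      have h1 := length_samplesIn_le hL r z (Nat.Odd.sub_odd hi odd_one)
      have h2 := length_samplesIn_le hL r z hi.add_one
      linarith

/-- Empirical optimality against `g` on the kept samples of one cell. Apart from membership in the
class, this is all that is used about the minimizers. -/
theorem sum_lossDiff_nonpos (hL : 0 < L) (herm : ∀ data, IsERM L data (erm data)) (r : Fin K)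
    (z : Fin M → unitInterval × unitInterval) (k : ℕ) {g : unitInterval → unitInterval}
    (hg : g ∈ lipClass L) :
    ∑ j, active (longCell L K (r + 1) k) (sampleCap K) j z *
      (longCell L K (r + 1) k).indicator (lossDiff (erm (labelledIn
        (preprocess L K r fun j => (z j).1) (fun j => (z j).2) (2 * k))) g) (z j) ≤ 0 := by
  set P := preprocess L K r fun j => (z j).1 with hP
  set f := erm (labelledIn P (fun j => (z j).2) (2 * k)) with hf
  have h := (herm (labelledIn P (fun j => (z j).2) (2 * k))).2 g hg
  have hemp : ∀ g, empErr (labelledIn P (fun j => (z j).2) (2 * k)) g =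
      ((samplesIn P (2 * k)).map fun j => |((z j).2 : ℝ) - g (z j).1|).sum := fun g => by
    rw [empErr, labelledIn, List.map_map]
    rfl
  rw [← hf, hemp, hemp, hP, sum_samplesIn hL r z k fun p => |(p.2 : ℝ) - f p.1|,
    sum_samplesIn hL r z k fun p => |(p.2 : ℝ) - g p.1|, ← sub_nonpos,
    ← Finset.sum_sub_distrib] at h
  refine (le_of_eq (Finset.sum_congr rfl fun j _ => ?_)).trans h
  by_cases hj : z j ∈ longCell L K (r + 1) k
  · simp only [Set.indicator_of_mem hj, lossDiff, mul_sub]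
  · simp [Set.indicator_of_notMem hj]

end Query

/-! ### The error bound -/

section Error

variable {L : ℝ} {K M : ℕ} {D : Measure (unitInterval × unitInterval)}

/-- The contribution of the `k`-th long interval to the bound for the excess error, for the
offset `(r + 1) / L`. -/
def cellBound (D : Measure (unitInterval × unitInterval)) (L : ℝ) (K k : ℕ) (r : Fin K)
    (z : Fin M → unitInterval × unitInterval) : ℝ :=
  -- A null cell contributes no error, and `excessBound` divides by the mass of the cell.
  if 0 < D.real (longCell L K (r + 1) k) then
    excessBound D (longCell L K (r + 1) k) (sampleCap K)
      (min (M * D.real (longCell L K (r + 1) k) / 2) (sampleCap K)) K (Nat.sqrt K + 1)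
      (gridIndex L (Nat.sqrt K + 1) (breakpoint L K (r + 1) (2 * k)))
      (fineSquares L K (Nat.sqrt K + 1) (r + 1) k)
      (coarseSquares L K (Nat.sqrt K + 1) (r + 1) k) z
  else 0

/-- The bound for the excess error. -/
def totalBound (D : Measure (unitInterval × unitInterval)) (L : ℝ) (K : ℕ)
    (ω : Fin K × (Fin M → unitInterval × unitInterval)) : ℝ :=
  ∑ k ∈ Finset.range (⌈L / K⌉₊ + 1), cellBound D L K k ω.1 ω.2 +
    D.real (shortRegion L K (ω.1 + 1))

/-- The grid parameter is `J = Nat.sqrt K + 1`, an integer with `K ≤ J ^ 2 ≤ 4 * K`. -/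
theorem le_sqrt_succ_sq (K : ℕ) : K ≤ (Nat.sqrt K + 1) ^ 2 := (Nat.lt_succ_sqrt' K).le

theorem sqrt_succ_sq_le (hK : 0 < K) : (Nat.sqrt K + 1) ^ 2 ≤ 4 * K := by
  have h1 : 1 ≤ Nat.sqrt K := Nat.sqrt_pos.2 hK
  have h2 := Nat.sqrt_le' K
  nlinarith

theorem cellBound_nonneg (k : ℕ) (r : Fin K) (z : Fin M → unitInterval × unitInterval) :
    0 ≤ cellBound D L K k r z := by
  unfold cellBound
  split_ifs with h
  · exact excessBound_nonneg (le_min (by positivity) (sampleCap_nonneg K)) ..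
  · exact le_rfl

theorem measurable_cellBound (k : ℕ) (r : Fin K) :
    Measurable (cellBound D L K k r : (Fin M → unitInterval × unitInterval) → ℝ) := by
  unfold cellBound
  split_ifs with h
  · exact measurable_excessBound (measurableSet_longCell ..) _ _ _ (measurable_gridIndex ..) _ _
  · exact measurable_const

theorem integrable_cellBound [IsProbabilityMeasure D] (k : ℕ) (r : Fin K) :
    Integrable (cellBound D L K k r) (Measure.pi fun _ : Fin M => D) := by
  unfold cellBound
  split_ifs with h
  · exact integrable_excessBound (measurableSet_longCell ..) _ _ _ (measurable_gridIndex ..) _ _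
  · exact integrable_const _

/-- The length is replaced by its maximum `K` only in the term carrying the mass of the cell, as
masses sum to at most `1`. In the `2 / M` term it is kept, as lengths sum to at most `L`. -/
theorem integral_cellBound_le [IsProbabilityMeasure D] (hL : 0 < L) (hM : 0 < M)
    (hτ : 1 ≤ sampleCap K) (k : ℕ) (r : Fin K) :
    ∫ z, cellBound D L K k r z ∂(Measure.pi fun _ : Fin M => D) ≤
      21 * D.real (longCell L K (r + 1) k) / K + 24 * (K : ℝ) ^ 2 *
        (2 / M * (longLength L K (r + 1) k + 1) +
          D.real (longCell L K (r + 1) k) / sampleCap K * (K + 1)) := by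
  have hK : 0 < K := r.pos
  have hK' : (0 : ℝ) < K := Nat.cast_pos.2 hK
  have hℓ0 := longLength_nonneg hL hK (Nat.succ_pos (r : ℕ)) k
  have hτ0 : 0 < sampleCap K := by linarith
  unfold cellBound
  split_ifs with h
  · refine (integral_excessBound_le (measurableSet_longCell ..) h hM hτ hK (le_sqrt_succ_sq K)
      (measurable_gridIndex ..) _ _).trans (add_le_add le_rfl ?_)
    have hne : (longCell L K (r + 1) k).Nonempty := by
      rw [Set.nonempty_iff_ne_empty]
      intro h0
      simp [h0] at h
    obtain ⟨z, hz⟩ := hne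
    have hℓ := longLength_le hL hK (Nat.succ_pos (r : ℕ)) (by omega) hz.1
    have hcard := card_squares_le hL hK (Nat.succ_pos (r : ℕ)) (Nat.succ_pos (Nat.sqrt K))
      (sqrt_succ_sq_le hK) k
    refine (mul_le_mul_of_nonneg_left hcard (by positivity)).trans ?_
    have h1 : D.real (longCell L K (r + 1) k) / sampleCap K * (longLength L K (r + 1) k + 1) ≤
        D.real (longCell L K (r + 1) k) / sampleCap K * (K + 1) :=
      mul_le_mul_of_nonneg_left (by linarith) (by positivity)
    calc _ = 24 * (K : ℝ) ^ 2 * (2 / M * (longLength L K (r + 1) k + 1) +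
          D.real (longCell L K (r + 1) k) / sampleCap K * (longLength L K (r + 1) k + 1)) := by
          ring
      _ ≤ _ := by gcongr
  · rw [integral_zero]
    positivity

theorem pairwise_disjoint_longCell (hL : 0 < L) {m : ℕ} (hK : 0 < K) (hm : 0 < m) :
    Pairwise (Function.onFun Disjoint (longCell L K m)) := by
  intro k k' hne
  refine Set.disjoint_left.2 fun z hz hz' => hne ?_
  have := cell_index_unique hL hK hm (iff_of_true (even_two_mul k) (even_two_mul k')) hz hz'
  omega

theorem compl_shortRegion (hL : 0 < L) {m : ℕ} (hK : 0 < K) (hm : 0 < m) :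
    (shortRegion L K m)ᶜ = ⋃ k ∈ Finset.range (⌈L / K⌉₊ + 1), longCell L K m k := by
  ext z
  simp only [shortRegion, Set.mem_compl_iff, Set.mem_ofPred_eq, not_forall, not_not,
    Set.mem_iUnion, Finset.mem_range, exists_prop]
  exact exists_congr fun k => ⟨fun h => ⟨lt_of_mem_long_cell hL hK hm h.1, h⟩, fun h => h.2⟩

theorem sum_longCell_le [IsProbabilityMeasure D] (hL : 0 < L) {m : ℕ} (hK : 0 < K) (hm : 0 < m)
    (N : ℕ) : ∑ k ∈ Finset.range N, D.real (longCell L K m k) ≤ 1 := by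
  rw [← measureReal_biUnion_finset]
  · exact measureReal_le_one
  · exact (pairwise_disjoint_longCell hL hK hm).set_pairwise _
  · exact fun _ _ => measurableSet_longCell ..

/-- The excess error of a predictor that agrees with the empirical risk minimizers on the long
intervals. -/
theorem err_le_add_totalBound [IsProbabilityMeasure D] (hL : 0 < L) (hM : 0 < M)
    (hτ : 0 < sampleCap K)
    {erm : List (unitInterval × unitInterval) → unitInterval → unitInterval}
    (herm : ∀ data, IsERM L data (erm data))
    (ω : Fin K × (Fin M → unitInterval × unitInterval)) {f g : unitInterval → unitInterval}
    (hf : f ∈ lipClass L) (hg : g ∈ lipClass L)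
    (hfq : ∀ x, (query erm (preprocess L K ω.1 fun j => (ω.2 j).1) x).output
      (fun j => (ω.2 j).2) = (f x : ℝ)) :
    err D f ≤ err D g + totalBound D L K ω := by
  obtain ⟨r, z⟩ := ω
  simp only at hfq ⊢
  have hK : 0 < K := r.pos
  have hloss : ∀ f ∈ lipClass L, Integrable
      (fun p : unitInterval × unitInterval => |(p.2 : ℝ) - f p.1|) D := fun f hf => by
    have := continuous_of_mem_lipClass hL hf
    refine integrable_of_abs_le (c := 1) (Continuous.measurable (by fun_prop)) fun p => ?_
    have h1 := p.2.2
    have h2 := (f p.1).2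
    rw [abs_abs, abs_le]; constructor <;> linarith [h1.1, h1.2, h2.1, h2.2]
  have hdiff : err D f - err D g = ∫ p, lossDiff f g p ∂D :=
    (integral_sub (hloss f hf) (hloss g hg)).symm
  have hint := integrable_lossDiff D hL hf hg
  rw [← integral_add_compl (measurableSet_shortRegion L K (r + 1)) hint,
    compl_shortRegion hL hK (Nat.succ_pos (r : ℕ)),
    integral_biUnion_finset _ (fun _ _ => measurableSet_longCell ..)
      ((pairwise_disjoint_longCell hL hK (Nat.succ_pos (r : ℕ))).set_pairwise _)
      (fun _ _ => hint.integrableOn)] at hdiff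
  have hshort : ∫ p in shortRegion L K (r + 1), lossDiff f g p ∂D ≤
      D.real (shortRegion L K (r + 1)) := by
    have := norm_setIntegral_le_of_norm_le_const (measure_lt_top D (shortRegion L K (r + 1)))
      (f := lossDiff f g) (C := 1) fun p _ => abs_lossDiff_le_one f g p
    rw [one_mul] at this
    exact (le_abs_self _).trans this
  have hcell : ∀ k ∈ Finset.range (⌈L / K⌉₊ + 1),
      ∫ p in longCell L K (r + 1) k, lossDiff f g p ∂D ≤ cellBound D L K k r z := by
    intro k _
    unfold cellBound
    split_ifs with hq
    · set e := erm (labelledIn (preprocess L K r fun j => (z j).1) (fun j => (z j).2) (2 * k))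
        with he
      have heL : e ∈ lipClass L := (herm _).1
      -- Over this cell `f` coincides with a single minimizer that lies in the class, so the
      -- chaining bound applies to it.
      have hfe : Set.EqOn (lossDiff f g) (lossDiff e g) (longCell L K (r + 1) k) := fun p hp => by
        have h1 := (query_long (erm := erm) (P := preprocess L K r fun j => (z j).1) hL hK
          (Nat.succ_pos (r : ℕ)) rfl (fun j => (z j).2) (even_two_mul k) hp).1
        rw [hfq] at h1
        simp only [lossDiff, h1, he]
      rw [setIntegral_congr_fun (measurableSet_longCell ..) hfe]
      have hJ : 0 < Nat.sqrt K + 1 := Nat.succ_pos _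
      have hJ' : (0 : ℝ) < (Nat.sqrt K + 1 : ℕ) := Nat.cast_pos.2 hJ
      set J := Nat.sqrt K + 1
      have hM' : (0 : ℝ) < M := Nat.cast_pos.2 hM
      refine setIntegral_le_excessBound (measurableSet_longCell ..) hq hM
        (lt_min (by positivity) hτ) (min_le_right _ _) (min_le_left _ _) hK hJ
        (measurable_gridIndex ..) (fun p hp => ?_) (fun p hp => ?_)
        (integrable_lossDiff D hL heL hg).integrableOn (fun p _ => abs_lossDiff_le_one e g p)
        (fun p hp p' hp' hpp => ?_) (fun p hp p' hp' hpp => ?_)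
        (sum_lossDiff_nonpos hL herm r z k hg)
      · have := gridIndex_mem (J := J) hL hp
        exact Finset.mem_product.2 ⟨Finset.mem_range.2 (Nat.lt_succ_of_le this.1),
          Finset.mem_range.2 (Nat.lt_succ_of_le this.2)⟩
      · have := gridIndex_mem (J := J) hL hp
        exact Finset.mem_product.2
          ⟨Finset.mem_range.2 (Nat.lt_succ_of_le (Nat.div_le_div_right this.1)),
          Finset.mem_range.2 (Nat.lt_succ_of_le (Nat.div_le_div_right this.2))⟩
      all_goals
        have hnn : 0 ≤ L * ((p.1 : ℝ) - breakpoint L K (r + 1) (2 * k)) :=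
          mul_nonneg hL.le (sub_nonneg.2 (Subtype.coe_le_coe.2 hp.2.1))
        have hnn' : 0 ≤ L * ((p'.1 : ℝ) - breakpoint L K (r + 1) (2 * k)) :=
          mul_nonneg hL.le (sub_nonneg.2 (Subtype.coe_le_coe.2 hp'.2.1))
        have hx : L * ((p.1 : ℝ) - breakpoint L K (r + 1) (2 * k)) -
            L * ((p'.1 : ℝ) - breakpoint L K (r + 1) (2 * k)) = L * ((p.1 : ℝ) - p'.1) := by ring
        have hlip := abs_lossDiff_sub_le heL hg p p'
        simp only [gridIndex, Prod.mk.injEq] at hpp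
      · have h1 := abs_sub_le_of_floor_eq hJ hnn hnn' hpp.1
        have h2 := abs_sub_le_of_floor_eq hJ p.2.2.1 p'.2.2.1 hpp.2
        rw [hx, abs_mul, abs_of_pos hL] at h1
        have h3 : 4 / (J : ℝ) ^ 2 = 4 * (1 / (J : ℝ) ^ 2) := by ring
        linarith
      · have h1 := abs_sub_le_of_floor_div_eq hJ hnn hnn' hpp.1
        have h2 := abs_sub_le_of_floor_div_eq hJ p.2.2.1 p'.2.2.1 hpp.2
        rw [hx, abs_mul, abs_of_pos hL] at h1
        have h3 : 4 / (J : ℝ) = 4 * (1 / (J : ℝ)) := by ring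
        linarith
    · have h0 : D (longCell L K (r + 1) k) = 0 := by
        have : D.real (longCell L K (r + 1) k) = 0 := le_antisymm (not_lt.1 hq) measureReal_nonneg
        exact (measureReal_eq_zero_iff).1 this
      rw [setIntegral_measure_zero _ h0]
  have hsum := Finset.sum_le_sum hcell
  unfold totalBound
  linarith

/-! ### Expectation over all random choices -/

theorem totalBound_nonneg (ω : Fin K × (Fin M → unitInterval × unitInterval)) :
    0 ≤ totalBound D L K ω :=
  add_nonneg (Finset.sum_nonneg fun _ _ => cellBound_nonneg ..) measureReal_nonneg

theorem measurable_totalBound :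
    Measurable (totalBound D L K : Fin K × (Fin M → unitInterval × unitInterval) → ℝ) := by
  refine measurable_from_prod_countable_right fun r => ?_
  exact (Finset.measurable_sum _ fun k _ => measurable_cellBound (D := D) (L := L) k r).add_const
    (D.real (shortRegion L K (r + 1)))

theorem integrable_totalBound_section [IsProbabilityMeasure D] (r : Fin K) :
    Integrable (fun z => totalBound D L K (r, z)) (Measure.pi fun _ : Fin M => D) :=
  (integrable_finsetSum _ fun k _ => integrable_cellBound k r).add
    (integrable_const (D.real (shortRegion L K (r + 1))))

/-- Here `309 = 21 + 192 + 96`: sampling noise, grid squares against the sample size `M`, and grid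
squares against the cap. The logarithms serve only through `1 ≤ Real.log K`. -/
theorem integral_totalBound_section_le [IsProbabilityMeasure D] (hL : 0 < L) (hK : 3 ≤ K)
    (hM : max L (1 / (K : ℝ)) * (K : ℝ) ^ 4 * Real.log K ≤ M) (hlog : 1 ≤ Real.log K)
    (r : Fin K) :
    ∫ z, totalBound D L K (r, z) ∂(Measure.pi fun _ : Fin M => D) ≤
      309 / K + D.real (shortRegion L K (r + 1)) := by
  have hK0 : 0 < K := r.pos
  have hK3 : (3 : ℝ) ≤ K := by exact_mod_cast hK
  have hK' : (0 : ℝ) < K := by linarith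
  have hm : 0 < (r : ℕ) + 1 := Nat.succ_pos _
  set N := ⌈L / K⌉₊ + 1 with hN
  set A := max L (1 / (K : ℝ)) with hA
  have hA0 : 0 < A := lt_max_of_lt_left hL
  have hMpos : (0 : ℝ) < M := lt_of_lt_of_le (by positivity) hM
  have hM0 : 0 < M := Nat.cast_pos.1 hMpos
  have hτ : (K : ℝ) ^ 4 / 2 ≤ sampleCap K := by
    unfold sampleCap
    have : (K : ℝ) ^ 4 * 1 ≤ (K : ℝ) ^ 4 * Real.log K :=
      mul_le_mul_of_nonneg_left hlog (by positivity)
    linarith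
  have hK4 : (81 : ℝ) ≤ (K : ℝ) ^ 4 := by
    calc (81 : ℝ) = 3 ^ 4 := by norm_num
      _ ≤ (K : ℝ) ^ 4 := pow_le_pow_left₀ (by norm_num) hK3 4
  have hτ1 : 1 ≤ sampleCap K := by linarith
  have hτ0 : 0 < sampleCap K := by linarith
  have hM2 : A * (K : ℝ) ^ 4 ≤ M := by
    refine le_trans ?_ hM
    exact le_mul_of_one_le_right (by positivity) hlog
  have hNle : (N : ℝ) ≤ L / K + 2 := by
    have := (Nat.ceil_lt_add_one (div_nonneg hL.le hK'.le) : (⌈L / K⌉₊ : ℝ) < L / K + 1)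
    rw [hN]; push_cast; linarith
  have hLN : L + N ≤ 4 * K * A := by
    have h1 : L ≤ A := le_max_left _ _
    have h2 : 1 ≤ K * A := by
      have : 1 / (K : ℝ) ≤ A := le_max_right _ _
      rwa [div_le_iff₀' hK'] at this
    have h3 : L / K ≤ A := (div_le_self hL.le (by linarith)).trans h1
    have h4 : 3 * A ≤ K * A := mul_le_mul_of_nonneg_right hK3 hA0.le
    linarith
  have e1 : 24 * (K : ℝ) ^ 2 * (2 / M * (L + N)) ≤ 192 / K := by
    rw [div_mul_eq_mul_div, mul_div_assoc', div_le_div_iff₀ hMpos hK']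
    calc 24 * (K : ℝ) ^ 2 * (2 * (L + N)) * K ≤ 24 * (K : ℝ) ^ 2 * (2 * (4 * K * A)) * K := by
          gcongr
      _ = 192 * (A * (K : ℝ) ^ 4) := by ring
      _ ≤ 192 * M := by linarith
  have e2 : 24 * (K : ℝ) ^ 2 * (1 / sampleCap K * (K + 1)) ≤ 96 / K := by
    rw [div_mul_eq_mul_div, mul_div_assoc', div_le_div_iff₀ hτ0 hK']
    calc 24 * (K : ℝ) ^ 2 * (1 * (K + 1)) * K ≤ 24 * (K : ℝ) ^ 2 * (1 * (2 * K)) * K := by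
          gcongr; linarith
      _ = 96 * ((K : ℝ) ^ 4 / 2) := by ring
      _ ≤ 96 * sampleCap K := by linarith
  have hq := sum_longCell_le (D := D) hL hK0 hm N
  have hℓ := sum_longLength_le hL hK0 hm N
  simp only [totalBound]
  rw [integral_add (integrable_finsetSum _ fun k _ => integrable_cellBound k r)
    (integrable_const _), integral_finsetSum _ fun k _ => integrable_cellBound k r]
  simp only [integral_const, probReal_univ, one_smul]
  refine add_le_add ?_ le_rfl
  refine (Finset.sum_le_sum fun k _ => integral_cellBound_le hL hM0 hτ1 k r).trans ?_
  rw [Finset.sum_add_distrib, ← Finset.mul_sum, Finset.sum_add_distrib, ← Finset.mul_sum,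
    ← Finset.sum_mul, ← Finset.sum_div, ← Finset.sum_div, ← Finset.mul_sum,
    Finset.sum_add_distrib, Finset.sum_const, Finset.card_range, nsmul_eq_mul, mul_one, mul_add]
  have e3 : 21 * ∑ k ∈ Finset.range N, D.real (longCell L K (r + 1) k) ≤ 21 := by linarith
  have e4 : 24 * (K : ℝ) ^ 2 * (2 / M * (∑ k ∈ Finset.range N, longLength L K (r + 1) k + N)) ≤
      24 * (K : ℝ) ^ 2 * (2 / M * (L + N)) := by gcongr
  have e5 : 24 * (K : ℝ) ^ 2 * ((∑ k ∈ Finset.range N, D.real (longCell L K (r + 1) k)) /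
      sampleCap K * (K + 1)) ≤ 24 * (K : ℝ) ^ 2 * (1 / sampleCap K * (K + 1)) := by gcongr
  have e6 := div_le_div_of_nonneg_right e3 hK'.le
  have e7 : (309 : ℝ) / K = 21 / K + (192 / K + 96 / K) := by ring
  linarith

theorem integrable_totalBound [IsProbabilityMeasure D] [NeZero K] :
    Integrable (totalBound D L K) (law D K M) := by
  refine (integrable_prod_iff measurable_totalBound.aestronglyMeasurable).2
    ⟨ae_of_all _ fun r => integrable_totalBound_section r, Integrable.of_finite⟩

/-- Averaging over the offset adds `1 / K` for the short regions to the `309 / K` of the long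
intervals. -/
theorem integral_totalBound_le [IsProbabilityMeasure D] (hL : 0 < L) (hK : 3 ≤ K)
    (hM : max L (1 / (K : ℝ)) * (K : ℝ) ^ 4 * Real.log K ≤ M) (hlog : 1 ≤ Real.log K) :
    ∫ ω, totalBound D L K ω ∂(law D K M) ≤ 310 / K := by
  have hK' : (0 : ℝ) < K := Nat.cast_pos.2 (by omega)
  have : NeZero K := ⟨by omega⟩
  have hint := integrable_totalBound (D := D) (L := L) (K := K) (M := M)
  unfold law at hint ⊢
  rw [integral_prod _ hint, integral_fintype Integrable.of_finite]
  have hw : ∀ r : Fin K, (ProbabilityTheory.uniformOn (Set.univ : Set (Fin K))).real {r} =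
      1 / K := fun r => by
    rw [measureReal_def, ProbabilityTheory.uniformOn_univ]
    simp
  simp only [hw, smul_eq_mul]
  rw [← Finset.mul_sum]
  have h1 := Finset.sum_le_sum fun (r : Fin K) (_ : r ∈ Finset.univ) =>
    integral_totalBound_section_le (D := D) (M := M) hL hK hM hlog r
  rw [Finset.sum_add_distrib, Finset.sum_const, Finset.card_univ, Fintype.card_fin,
    nsmul_eq_mul, mul_div_cancel₀ _ hK'.ne'] at h1
  have h2 := sum_measureReal_shortRegion_le D hL K
  rw [one_div_mul_eq_div]
  exact div_le_div_of_nonneg_right (by linarith) hK'.le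

/-- Markov's inequality: the mean `310 / K` is at most `0.31 * ε`, so failure has probability at
most `0.31`. -/
theorem half_lt_law [IsProbabilityMeasure D] (hL : 0 < L) (hK : 3 ≤ K)
    (hM : max L (1 / (K : ℝ)) * (K : ℝ) ^ 4 * Real.log K ≤ M) (hlog : 1 ≤ Real.log K) {ε : ℝ}
    (hKε : 1000 ≤ K * ε) :
    1 / 2 < law D K M {ω | totalBound D L K ω ≤ ε} := by
  have hK' : (0 : ℝ) < K := Nat.cast_pos.2 (by omega)
  have : NeZero K := ⟨by omega⟩
  have hprob : IsProbabilityMeasure (law D K M) := by unfold law; infer_instance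
  have hmarkov := mul_meas_ge_le_integral_of_nonneg (μ := law D K M)
    (ae_of_all _ (totalBound_nonneg (D := D) (L := L) (K := K) (M := M))) integrable_totalBound ε
  have h1 := hmarkov.trans (integral_totalBound_le hL hK hM hlog)
  have h2 : (law D K M).real {ω | ε ≤ totalBound D L K ω} ≤ 310 / 1000 := by
    rw [le_div_iff₀ hK'] at h1
    have h3 : 0 ≤ (law D K M).real {ω | ε ≤ totalBound D L K ω} := measureReal_nonneg
    nlinarith
  have hE : MeasurableSet {ω : Fin K × (Fin M → unitInterval × unitInterval) |
      totalBound D L K ω ≤ ε} := measurableSet_le measurable_totalBound measurable_const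
  have h3 : (law D K M).real {ω | totalBound D L K ω ≤ ε}ᶜ ≤ 310 / 1000 :=
    (measureReal_mono (show {ω | totalBound D L K ω ≤ ε}ᶜ ⊆ {ω | ε ≤ totalBound D L K ω} from
      fun ω hω => (not_le.1 (show ¬ totalBound D L K ω ≤ ε from hω)).le)).trans h2
  rw [probReal_compl_eq_one_sub hE] at h3
  have h4 : 1 / 2 < (law D K M).real {ω | totalBound D L K ω ≤ ε} := by linarith
  have h5 := (ENNReal.ofReal_lt_iff_lt_toReal (by norm_num) (measure_ne_top _ _)).2 h4
  rwa [ENNReal.ofReal_div_of_pos (by norm_num), ENNReal.ofReal_one, ENNReal.ofReal_ofNat] at h5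

/-! ### Sizes -/

theorem log_inverse_accuracy_le {ε : ℝ} (hε : 0 < ε) (hε1 : ε ≤ 1) (hK0 : 0 < K)
    (hK : (K : ℝ) ≤ 1001 / ε) : Real.log K ≤ 10 * Real.log (2 / ε) := by
  have hK' : (0 : ℝ) < K := Nat.cast_pos.2 hK0
  have h1 : (K : ℝ) ≤ (2 / ε) ^ 10 := by
    refine hK.trans ?_
    have h2 : 1 ≤ 1 / ε := (one_le_div hε).2 hε1
    have h3 : 1 / ε ≤ (1 / ε) ^ 10 := le_self_pow₀ h2 (by norm_num)
    calc 1001 / ε = 1001 * (1 / ε) := by ring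
      -- `1024 = 2 ^ 10` exceeds `1001`, which is the source of the factor `10`.
      _ ≤ 1024 * (1 / ε) ^ 10 := by nlinarith
      _ = (2 / ε) ^ 10 := by ring
  calc Real.log K ≤ Real.log ((2 / ε) ^ 10) := Real.log_le_log hK' h1
    _ = 10 * Real.log (2 / ε) := by rw [Real.log_pow]; norm_num

theorem half_le_log_two_div {ε : ℝ} (hε : 0 < ε) (hε1 : ε ≤ 1) : 1 / 2 ≤ Real.log (2 / ε) := by
  have h1 : (2 : ℝ) ≤ 2 / ε := by rw [le_div_iff₀ hε]; linarith
  have h2 := Real.log_le_log (by norm_num) h1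
  have h3 := Real.log_two_gt_d9
  linarith

theorem pow_four_mul_log_le {ε : ℝ} (hε : 0 < ε) (hε1 : ε ≤ 1) (hK0 : 0 < K)
    (hK : (K : ℝ) ≤ 1001 / ε) :
    (K : ℝ) ^ 4 * Real.log K ≤ 10 * 1001 ^ 4 * (1 / ε ^ 4 * Real.log (2 / ε)) := by
  have h1 := log_inverse_accuracy_le hε hε1 hK0 hK
  have h2 : (K : ℝ) ^ 4 ≤ (1001 / ε) ^ 4 := pow_le_pow_left₀ (Nat.cast_nonneg _) hK 4
  calc (K : ℝ) ^ 4 * Real.log K ≤ (1001 / ε) ^ 4 * (10 * Real.log (2 / ε)) :=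
        mul_le_mul h2 h1 (Real.log_natCast_nonneg K) (by positivity)
    _ = _ := by ring

end Error

end LocalLipschitz

end

/-! ### Choice of constants and conclusion -/

theorem mainTheorem1 :
    ∃ A B C : ℝ, 0 < A ∧ 0 < B ∧ 0 < C ∧
      ∀ (D : MeasureTheory.Measure (unitInterval × unitInterval))
        [MeasureTheory.IsProbabilityMeasure D] (L ε : ℝ),
        0 < L → 0 < ε → ε ≤ 1 →
        ∀ K M : ℕ, K = ⌈A / ε⌉₊ → M = LocalLipschitz.sampleSize C L K →
          (M : ℝ) ≤ B * (max L ε / ε ^ 4 * Real.log (2 / ε)) ∧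
          ∀ erm : List (unitInterval × unitInterval) → unitInterval → unitInterval,
            (∀ data, LocalLipschitz.IsERM L data (erm data)) →
            ∃ ftilde : Fin K × (Fin M → unitInterval × unitInterval) →
                unitInterval → unitInterval,
              (∀ ω : Fin K × (Fin M → unitInterval × unitInterval),
                ftilde ω ∈ LocalLipschitz.lipClass L ∧
                ∀ x : unitInterval,
                  (LocalLipschitz.query erm
                    (LocalLipschitz.preprocess L K ω.1 fun j => (ω.2 j).1) x).output
                      (fun j => (ω.2 j).2) = (ftilde ω x : ℝ) ∧
                  (∀ j ∈ (LocalLipschitz.query erm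
                    (LocalLipschitz.preprocess L K ω.1 fun j => (ω.2 j).1) x).queries
                      (fun j => (ω.2 j).2),
                    j ∈ (LocalLipschitz.preprocess L K ω.1 fun j => (ω.2 j).1).kept) ∧
                  (((LocalLipschitz.query erm
                    (LocalLipschitz.preprocess L K ω.1 fun j => (ω.2 j).1) x).queries
                      (fun j => (ω.2 j).2)).length : ℝ) ≤
                    B * (1 / ε ^ 4 * Real.log (2 / ε))) ∧
              ∃ E : Set (Fin K × (Fin M → unitInterval × unitInterval)),
                MeasurableSet E ∧ 1 / 2 < LocalLipschitz.law D K M E ∧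
                ∀ ω ∈ E, LocalLipschitz.err D (ftilde ω) ≤ LocalLipschitz.optErr D L + ε := by
  -- `A = 1000` leaves room in Markov's inequality and makes `Real.log K ≥ 1`. In `B`, the first
  -- term bounds `K ^ 4 * Real.log K` and the `4` absorbs rounding: a query may cost `2` extra
  -- labels, while `1 / ε ^ 4 * Real.log (2 / ε)` is only known to be at least `1 / 2`.
  refine ⟨1000, 10 * 1001 ^ 4 + 4, 1, by norm_num, by norm_num, by norm_num, ?_⟩
  intro D _ L ε hL hε hε1 K M hK hM
  have hinv : 1 ≤ 1 / ε := (one_le_div hε).2 hε1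
  have hKlow : 1000 / ε ≤ K := hK ▸ Nat.le_ceil _
  have hKup : (K : ℝ) ≤ 1001 / ε := by
    have h := (Nat.ceil_lt_add_one (div_nonneg (by norm_num) hε.le) :
      (⌈1000 / ε⌉₊ : ℝ) < 1000 / ε + 1)
    rw [← hK] at h
    have h2 : 1001 / ε = 1000 / ε + 1 / ε := by ring
    linarith
  have hK1000 : (1000 : ℝ) ≤ K := by
    have : 1000 / ε = 1000 * (1 / ε) := by ring
    linarith
  have hK3 : 3 ≤ K := by
    have : (3 : ℝ) ≤ K := by linarith
    exact_mod_cast this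
  have hK' : (0 : ℝ) < K := by linarith
  have hKε : 1000 ≤ K * ε := (div_le_iff₀ hε).1 hKlow
  have hlog : 1 ≤ Real.log K := by
    rw [Real.le_log_iff_exp_le hK']
    have := Real.exp_one_lt_d9
    linarith
  have hpow := LocalLipschitz.pow_four_mul_log_le hε hε1 (by omega) hKup
  have hhalf := LocalLipschitz.half_le_log_two_div hε hε1
  have hinv4 : 1 ≤ 1 / ε ^ 4 := (one_le_div (by positivity)).2 (pow_le_one₀ hε.le hε1)
  have hsize : max L (1 / (K : ℝ)) * (K : ℝ) ^ 4 * Real.log K ≤ M := by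
    rw [hM, LocalLipschitz.sampleSize, one_mul]
    exact Nat.le_ceil _
  have hτ : 0 < LocalLipschitz.sampleCap K := by unfold LocalLipschitz.sampleCap; positivity
  have hM0 : 0 < M := by
    have : (0 : ℝ) < M := lt_of_lt_of_le (by positivity) hsize
    exact Nat.cast_pos.1 this
  refine ⟨?_, fun erm herm => ?_⟩
  · have h1 : (M : ℝ) < 1 * max L (1 / (K : ℝ)) * (K : ℝ) ^ 4 * Real.log K + 1 := by
      rw [hM]
      exact Nat.ceil_lt_add_one (by positivity)
    have h2 : max L (1 / (K : ℝ)) ≤ max L ε := by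
      refine max_le_max le_rfl ?_
      rw [div_le_iff₀' hK']
      linarith
    have h3 : max L (1 / (K : ℝ)) * ((K : ℝ) ^ 4 * Real.log K) ≤
        max L ε * (10 * 1001 ^ 4 * (1 / ε ^ 4 * Real.log (2 / ε))) :=
      mul_le_mul h2 hpow (by positivity) (by positivity)
    -- This absorbs the rounding up of `M`; it relies on the maximum being at least `ε`, however
    -- small `L` is.
    have h4 : 1 ≤ max L ε * (1 / ε ^ 4) := by
      have h5 : ε * (1 / ε) ≤ max L ε * (1 / ε ^ 4) := by
        refine mul_le_mul (le_max_right _ _) ?_ (by positivity) (by positivity)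
        exact one_div_le_one_div_of_le (by positivity) (pow_le_of_le_one hε.le hε1 (by norm_num))
      rwa [mul_one_div_cancel hε.ne'] at h5
    have h6 : 1 * (1 / 2) ≤ max L ε * (1 / ε ^ 4) * Real.log (2 / ε) :=
      mul_le_mul h4 hhalf (by norm_num) (by linarith)
    have h7 : max L ε / ε ^ 4 * Real.log (2 / ε) =
      max L ε * (1 / ε ^ 4) * Real.log (2 / ε) := by ring
    rw [h7]
    linarith
  · have hmem : ∀ (ω : Fin K × (Fin M → unitInterval × unitInterval)) (x : unitInterval),
        (LocalLipschitz.query erm (LocalLipschitz.preprocess L K ω.1 fun j => (ω.2 j).1) x).output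
          (fun j => (ω.2 j).2) ∈ Set.Icc (0 : ℝ) 1 := fun ω x =>
      LocalLipschitz.output_query_mem hL ω.1.pos (Nat.succ_pos (ω.1 : ℕ)) rfl _ x
    have hlip : ∀ ω : Fin K × (Fin M → unitInterval × unitInterval),
        (fun x => ⟨_, hmem ω x⟩ : unitInterval → unitInterval) ∈ LocalLipschitz.lipClass L :=
      fun ω x x' => LocalLipschitz.lipschitz_output_query hL ω.1.pos (Nat.succ_pos (ω.1 : ℕ)) rfl
        herm _ x x'
    refine ⟨fun ω x => ⟨_, hmem ω x⟩, fun ω => ⟨hlip ω, fun x => ⟨rfl, ?_, ?_⟩⟩,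
      {ω | LocalLipschitz.totalBound D L K ω ≤ ε},
      measurableSet_le LocalLipschitz.measurable_totalBound measurable_const,
      LocalLipschitz.half_lt_law hL hK3 hsize hlog hKε, fun ω hω => ?_⟩
    · exact (LocalLipschitz.queries_query hL ω.1 ω.2 x).1
    · refine (LocalLipschitz.queries_query hL ω.1 ω.2 x).2.trans ?_
      have h6 : 1 * (1 / 2) ≤ 1 / ε ^ 4 * Real.log (2 / ε) :=
        mul_le_mul hinv4 hhalf (by norm_num) (by linarith)
      rw [LocalLipschitz.sampleCap]
      linarith
    · rw [← sub_le_iff_le_add]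
      -- The event does not depend on the competitor `g`, so the bound passes to the infimum on the
      -- same event.
      refine le_csInf ((Set.nonempty_of_mem (hlip ω)).image _) ?_
      rintro _ ⟨g, hg, rfl⟩
      have := LocalLipschitz.err_le_add_totalBound (D := D) hL hM0 hτ herm ω (hlip ω) hg
        fun x => rfl
      have hω' : LocalLipschitz.totalBound D L K ω ≤ ε := hω
      linarith
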